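/- Let $1\le d\le 3$ and let either (Neumann case) $\Omega\subset\mathbb R^d$ be a bounded domain with $C^1$ boundary, or (periodic case) $\Omega=(0,L)^d$ with $L>0$. Let $\dot H^1$ be $H^1(\Omega)$ in the Neumann case and $H^1_{per}(\Omega)$ in the periodic case, $|v|_1=\|\nabla v\|_{L^2(\Omega)}$, and let $A=-\Delta$ be the self-adjoint operator on $L^2(\Omega)$ with the corresponding boundary condition, i.e. $v\in\mathcal D(A)$, $Av=h\in L^2(\Omega)$ iff $v\in\dot H^1$ and $(\nabla v,\nabla\chi)=(h,\chi)$ for all $\chi\in\dot H^1$. Put $m(v)=\frac1{|\Omega|}\int_\Omega v\,dx$, $\bar v=v-m(v)$ and $|v|_{-1}=\sup_{\chi\in\dot H^1}|(v,\chi)|/|\chi|_1$ (with $0/0=0$). Let $f=F'$ on $\mathbb R$, $F(0)=0$, and let $p\ge 2$ be real ($p=2$ if $d=3$), $c_0>0$, $c_1,c_3\in\mathbb R$ and $c_2:(0,\infty)\to\mathbb R$ be such that for all $v\in\mathbb R$, $\eta>0$ (reading $v^{2p}$ as $|v|^{2p}$) $$f(v)v\ge pc_0v^{2p}-c_1,\qquad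 |f(v)|\le\eta c_0v^{2p}+c_2(\eta),\qquad \tfrac12c_0v^{2p}-c_3\le F(v)\le\tfrac32c_0v^{2p}+c_3 .$$ Let $\varepsilon,c>0$, let $0=t^0<t^1<\cdots$ with $t^n\to\infty$, and let $k_n=t^{n+1}-t^n$, $k=\sup_nk_n$. Let $u^0=u_0\in L^2(\Omega)$ and let $(u^n)$ solve the implicit Euler scheme for the Cahn–Hilliard equation, $$\frac{u^{n+1}-u^n}{k_n}+Aw^{n+1}=0,\qquad w^{n+1}=\varepsilon Au^{n+1}+f(u^{n+1}),\qquad u^{n+1},w^{n+1}\in\mathcal D(A),\quad n\ge0 .$$ **Theorem (Time uniform bound in $H^{-1}$).** There is a constant $\gamma_1>0$ depending only on $\Omega$ and the type of boundary condition such that $|\bar v|_{-1}\le\gamma_1|v|_1$ for all $v\in\dot H^1$. For any such $\gamma_1$ the following holds. Let $k\le 8\varepsilon/c^2$, $|\overline{u_0}|_{-1}\le R$ with $R\ge0$, and $|m(u_0)|\le\alpha$. Put $$\hat\rho_0=\sqrt{2C_1(\alpha)}\Big(\frac{\gamma_1^2}{\varepsilon}+\frac{8\varepsilon}{c^2}\Big)^{1/2},\qquad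 C_1(\alpha)=(c_1+c_2\alpha+2c_3)|\Omega|,\qquad c_2=c_2\Big(\frac{p-3/2}{\alpha}\Big),$$ where $c_2\alpha$ is read as $0$ if $\alpha=0$. Then $$|\overline{u^n}|_{-1}\le\max\{R,\hat\rho_0\}\qquad\text{for all }n\ge0 .$$ Moreover, if $\hat\rho_0>0$, then $$|\overline{u^n}|_{-1}\le2\hat\rho_0\qquad\text{for all }n\ge n_0,$$ where $n_0$ is any index with $t^{n_0}\ge\big(\frac{\gamma_1^2}{\varepsilon}+\frac{8\varepsilon}{c^2}\big)\ln(R^2/\hat\rho_0^2)$ (no condition on $n_0$ if $R=0$); a positive such $n_0$ exists, and it does not depend on $u_0$ beyond $R$ and $\alpha$. -/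

import Mathlib

open MeasureTheory Filter Set
open scoped ContDiff ENNReal

noncomputable section

namespace CahnHilliard

/-- The two types of boundary condition: no flux (Neumann), or periodic with period `L` in every
coordinate direction. -/
inductive BoundaryCondition where
  | neumann : BoundaryCondition
  | periodic (L : ℝ) : BoundaryCondition

/-- `Ω` has a boundary of class `C¹`: near each boundary point, `Ω` is the sublevel set
`{ρ < 0}` of a `C¹` function `ρ` whose differential at that point is not zero. -/
def HasC1Boundary {d : ℕ} (Ω : Set (EuclideanSpace ℝ (Fin d))) : Prop :=
  ∀ x ∈ frontier Ω, ∃ (V : Set (EuclideanSpace ℝ (Fin d))) (ρ : EuclideanSpace ℝ (Fin d) → ℝ),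
    IsOpen V ∧ x ∈ V ∧ ContDiffOn ℝ 1 ρ V ∧ fderiv ℝ ρ x ≠ 0 ∧ Ω ∩ V = {y ∈ V | ρ y < 0}

/-- The spatial domains: a bounded domain with `C¹` boundary in the Neumann case, the open cube
`(0, L)^d` in the periodic case. -/
def BoundaryCondition.Admissible {d : ℕ} (Ω : Set (EuclideanSpace ℝ (Fin d))) :
    BoundaryCondition → Prop
  | .neumann => IsOpen Ω ∧ IsConnected Ω ∧ Bornology.IsBounded Ω ∧ HasC1Boundary Ω
  | .periodic L => 0 < L ∧ Ω = {x | ∀ i, x i ∈ Ioo 0 L}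

/-- Smooth test functions for weak derivatives: compactly supported in `Ω` in the Neumann case,
`L`-periodic in each coordinate in the periodic case. -/
def BoundaryCondition.IsTest {d : ℕ} (Ω : Set (EuclideanSpace ℝ (Fin d)))
    (φ : EuclideanSpace ℝ (Fin d) → ℝ) : BoundaryCondition → Prop
  | .neumann => ContDiff ℝ ∞ φ ∧ HasCompactSupport φ ∧ tsupport φ ⊆ Ω
  | .periodic L => ContDiff ℝ ∞ φ ∧ ∀ x i, φ (x + EuclideanSpace.single i L) = φ x

/-- `v` belongs to the space `Ḣ¹ = D(A^{1/2})`, which is `H¹(Ω)` in the Neumann case and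
`H¹_per(Ω)` in the periodic case, and `g` is its weak gradient. Hence
`|v|₁ = ‖A^{1/2} v‖ = ‖g‖_{L²(Ω)}`. -/
structure IsWeakGradient {d : ℕ} (bc : BoundaryCondition) (Ω : Set (EuclideanSpace ℝ (Fin d)))
    (v : EuclideanSpace ℝ (Fin d) → ℝ)
    (g : EuclideanSpace ℝ (Fin d) → EuclideanSpace ℝ (Fin d)) : Prop where
  memLp : MemLp v 2 (volume.restrict Ω)
  memLp_grad : MemLp g 2 (volume.restrict Ω)
  integral_eq : ∀ φ, bc.IsTest Ω φ → ∀ y,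
    ∫ x in Ω, v x * fderiv ℝ φ x y = -∫ x in Ω, inner ℝ (g x) y * φ x

/-- `v ∈ D(A)` and `A v = h`, where `A = -Δ` is the self-adjoint operator on `L²(Ω)` with the
given boundary condition, i.e. the operator of the form `(∇v, ∇χ)` on `Ḣ¹`. A function of
class `H²` that satisfies the Neumann or the periodic boundary condition lies in `D(A)` by Green's
formula. -/
def IsNegLaplacian {d : ℕ} (bc : BoundaryCondition) (Ω : Set (EuclideanSpace ℝ (Fin d)))
    (v h : EuclideanSpace ℝ (Fin d) → ℝ) : Prop :=
  MemLp h 2 (volume.restrict Ω) ∧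
    ∃ g, IsWeakGradient bc Ω v g ∧ ∀ χ G, IsWeakGradient bc Ω χ G →
      ∫ x in Ω, inner ℝ (g x) (G x) = ∫ x in Ω, h x * χ x

/-- The norm `|v|₋₁ = sup_{χ ∈ Ḣ¹} |(v, χ)| / |χ|₁`, with values in `[0, ∞]` and `0 / 0 = 0`
(it is `∞` if `v` does not have mean zero). -/
def hNegOneNorm {d : ℕ} (bc : BoundaryCondition) (Ω : Set (EuclideanSpace ℝ (Fin d)))
    (v : EuclideanSpace ℝ (Fin d) → ℝ) : ℝ≥0∞ :=
  ⨆ (χ : EuclideanSpace ℝ (Fin d) → ℝ)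
    (G : EuclideanSpace ℝ (Fin d) → EuclideanSpace ℝ (Fin d)) (_ : IsWeakGradient bc Ω χ G),
    ENNReal.ofReal |∫ x in Ω, v x * χ x| / eLpNorm G 2 (volume.restrict Ω)

/-- The average `m(v)` of `v` over `Ω`. -/
def mean {d : ℕ} (Ω : Set (EuclideanSpace ℝ (Fin d))) (v : EuclideanSpace ℝ (Fin d) → ℝ) : ℝ :=
  (volume.real Ω)⁻¹ * ∫ x in Ω, v x

/-- The mean-free part `v - m(v)`. -/
def meanFree {d : ℕ} (Ω : Set (EuclideanSpace ℝ (Fin d))) (v : EuclideanSpace ℝ (Fin d) → ℝ) :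
    EuclideanSpace ℝ (Fin d) → ℝ :=
  fun x => v x - mean Ω v

/-- `γ₁ > 0` is an admissible constant in `|v - m(v)|₋₁ ≤ γ₁ |v|₁`, `v ∈ Ḣ¹`. -/
def IsNegOneConstant {d : ℕ} (bc : BoundaryCondition) (Ω : Set (EuclideanSpace ℝ (Fin d)))
    (γ₁ : ℝ) : Prop :=
  0 < γ₁ ∧ ∀ v g, IsWeakGradient bc Ω v g →
    hNegOneNorm bc Ω (meanFree Ω v) ≤ ENNReal.ofReal γ₁ * eLpNorm g 2 (volume.restrict Ω)

/-- The assumptions on the nonlinearity `f` and its primitive `F` in dimension `d`;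
`|v| ^ (2 * p)` is `v^{2p}`, and `c₂` depends on `η`. -/
structure IsNonlinearity (d : ℕ) (p : ℝ) (f F : ℝ → ℝ) (c₀ c₁ : ℝ) (c₂ : ℝ → ℝ) (c₃ : ℝ) :
    Prop where
  two_le : 2 ≤ p
  eq_two : d = 3 → p = 2
  c₀_pos : 0 < c₀
  lower : ∀ v, p * c₀ * |v| ^ (2 * p) - c₁ ≤ f v * v
  growth : ∀ η, 0 < η → ∀ v, |f v| ≤ η * c₀ * |v| ^ (2 * p) + c₂ η
  primitive : ∀ v, HasDerivAt F (f v) v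
  primitive_zero : F 0 = 0
  primitive_lower : ∀ v, 1 / 2 * c₀ * |v| ^ (2 * p) - c₃ ≤ F v
  primitive_upper : ∀ v, F v ≤ 3 / 2 * c₀ * |v| ^ (2 * p) + c₃

/-- `0 = t⁰ < t¹ < ⋯` is a partition of `[0, ∞)`. -/
structure IsTimeGrid (t : ℕ → ℝ) : Prop where
  zero : t 0 = 0
  strictMono : StrictMono t
  tendsto : Tendsto t atTop atTop

/-- `(uⁿ)` solves the implicit Euler scheme on the grid `t`: with `kₙ = tⁿ⁺¹ - tⁿ`,
`(uⁿ⁺¹ - uⁿ) / kₙ + A wⁿ⁺¹ = 0` and `wⁿ⁺¹ = ε A uⁿ⁺¹ + f(uⁿ⁺¹)`. Here `a` stands for `A uⁿ⁺¹`,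
and `w` for the discrete chemical potential `wⁿ⁺¹`. -/
def IsImplicitEuler {d : ℕ} (bc : BoundaryCondition) (Ω : Set (EuclideanSpace ℝ (Fin d)))
    (ε : ℝ) (f : ℝ → ℝ) (t : ℕ → ℝ) (u : ℕ → EuclideanSpace ℝ (Fin d) → ℝ) : Prop :=
  MemLp (u 0) 2 (volume.restrict Ω) ∧ ∀ n, ∃ a w : EuclideanSpace ℝ (Fin d) → ℝ,
    IsNegLaplacian bc Ω (u (n + 1)) a ∧
    (∀ᵐ x ∂volume.restrict Ω, w x = ε * a x + f (u (n + 1) x)) ∧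
    IsNegLaplacian bc Ω w (fun x => -((u (n + 1) x - u n x) / (t (n + 1) - t n)))

/-- `C₁(α) = (c₁ + c₂ α + 2 c₃) |Ω|`, where `c₂ = c₂(η)` for `η = (p - 3/2) / α`
(for `α = 0` the term `c₂ α` is zero). -/
def C₁ {d : ℕ} (Ω : Set (EuclideanSpace ℝ (Fin d))) (p c₁ : ℝ) (c₂ : ℝ → ℝ) (c₃ α : ℝ) : ℝ :=
  (c₁ + c₂ ((p - 3 / 2) / α) * α + 2 * c₃) * volume.real Ω

/-- The radius `√(2 C₁(α)) (γ₁² / ε + 8 ε / c²)^{1/2}`. -/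
def rhoHat {d : ℕ} (Ω : Set (EuclideanSpace ℝ (Fin d))) (p c₁ : ℝ) (c₂ : ℝ → ℝ)
    (c₃ c ε γ₁ α : ℝ) : ℝ :=
  √(2 * C₁ Ω p c₁ c₂ c₃ α) * √(γ₁ ^ 2 / ε + 8 * ε / c ^ 2)

end CahnHilliard

end

/-!
The seminorm `|·|₋₁` is dual to the Dirichlet form, so testing the scheme with `χ + kₙ wⁿ⁺¹` instead
of `χ` gives `|ūⁿ⁺¹|₋₁² + 2kₙ (ūⁿ⁺¹, wⁿ⁺¹) ≤ |ūⁿ|₋₁²`, the mean `m(uⁿ)` being conserved. The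
potential satisfies `(ū, w) = ε|u|₁² + (ū, f(u)) ≥ (ε/γ₁²)|ū|₋₁² - C₁`. With `g = γ₁²/ε` this is the
recursion `yₙ₊₁(1 + 2kₙ/g) ≤ yₙ + 2kₙC₁` for `yₙ = |ūⁿ|₋₁²`, whose fixed point `C₁g` is at most
`ρ̂₀²`; since `exp(kₙ/(g + K)) ≤ 1 + 2kₙ/g` whenever `kₙ ≤ K`, the excess over `C₁g` decays like
`exp(-tⁿ/(g + K))`, here with `K = 8ε/c²`.

The constant `γ₁` comes from the Poincaré inequality. If all segments from points `y` of a piece of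
`Ω` to points `b` of a ball stay in `Ω`, then `|v(y) - v(b)|²` is controlled by integrating `|∇v|²`
along them; overlapping pieces combine, and a connected bounded `C¹` domain is a finite union of
such pieces. Only test functions supported in `Ω` enter, and these extend periodically.
-/

noncomputable section

namespace CahnHilliard

section Segments

theorem sq_lintegral_mul_le {α : Type*} [MeasurableSpace α] {μ : Measure α} {w f : α → ℝ≥0∞}
    (hw : AEMeasurable w μ) (hf : AEMeasurable f μ) (hw_le : ∫⁻ x, w x ∂μ ≤ 1) :
    (∫⁻ x, w x * f x ∂μ) ^ 2 ≤ ∫⁻ x, w x * f x ^ 2 ∂μ := by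
  have lintegral_weighted (h : α → ℝ≥0∞) (hh : AEMeasurable h μ) :
      ∫⁻ x, h x ∂μ.withDensity w = ∫⁻ x, w x * h x ∂μ :=
    lintegral_withDensity_eq_lintegral_mul₀ hw hh
  have holder := ENNReal.lintegral_mul_le_Lp_mul_Lq (μ.withDensity w) Real.HolderConjugate.two_two
    (hf.mono' (withDensity_absolutelyContinuous μ w)) (g := 1) aemeasurable_const
  simp only [Pi.mul_apply, Pi.one_apply, mul_one, ENNReal.rpow_two, one_pow,
    lintegral_one, withDensity_apply _ MeasurableSet.univ, Measure.restrict_univ,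
    lintegral_weighted _ hf, lintegral_weighted _ (hf.pow_const 2)] at holder
  calc (∫⁻ x, w x * f x ∂μ) ^ 2
      ≤ ((∫⁻ x, w x * f x ^ 2 ∂μ) ^ (1 / 2 : ℝ) * 1) ^ 2 := by
        gcongr
        exact holder.trans (by gcongr; exact ENNReal.rpow_le_one hw_le (by norm_num))
    _ = ∫⁻ x, w x * f x ^ 2 ∂μ := by
        rw [mul_one, ← ENNReal.rpow_two, ← ENNReal.rpow_mul]; norm_num

variable {E : Type*} [NormedAddCommGroup E]

theorem sq_enorm_sub_le_lintegral_segment [NormedSpace ℝ E] {v : E → ℝ} (hv : ContDiff ℝ 1 v)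
    (y b : E) :
    ‖v y - v b‖ₑ ^ 2 ≤
      ∫⁻ s in Icc (0 : ℝ) 1, ‖fderiv ℝ v (b + s • (y - b)) (y - b)‖ₑ ^ 2 := by
  have hasDerivAt_segment (s : ℝ) : HasDerivAt (fun s : ℝ => v (b + s • (y - b)))
      (fderiv ℝ v (b + s • (y - b)) (y - b)) s := by
    have : HasDerivAt (fun s : ℝ => b + s • (y - b)) (y - b) s := by
      simpa using ((hasDerivAt_id s).smul_const (y - b)).const_add b
    exact ((hv.differentiable one_ne_zero) _).hasFDerivAt.comp_hasDerivAt s this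
  have hcont : Continuous fun s : ℝ => fderiv ℝ v (b + s • (y - b)) (y - b) := by
    have := hv.continuous_fderiv one_ne_zero
    fun_prop
  have ftc := intervalIntegral.integral_eq_sub_of_hasDerivAt (a := 0) (b := 1)
    (fun s _ => hasDerivAt_segment s) (hcont.intervalIntegrable _ _)
  simp only [one_smul, zero_smul, add_zero, add_sub_cancel] at ftc
  rw [← ftc, intervalIntegral.integral_of_le zero_le_one, ← integral_Icc_eq_integral_Ioc]
  calc _ ≤ (∫⁻ s in Icc (0 : ℝ) 1, 1 * ‖fderiv ℝ v (b + s • (y - b)) (y - b)‖ₑ) ^ 2 := by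
        simp only [one_mul]
        gcongr
        exact enorm_integral_le_lintegral_enorm _
    _ ≤ ∫⁻ s in Icc (0 : ℝ) 1, 1 * ‖fderiv ℝ v (b + s • (y - b)) (y - b)‖ₑ ^ 2 :=
        sq_lintegral_mul_le aemeasurable_const hcont.measurable.enorm.aemeasurable (by simp)
    _ = _ := by simp only [one_mul]

variable [InnerProductSpace ℝ E] [FiniteDimensional ℝ E] [MeasurableSpace E] [BorelSpace E]
  {h : E → ℝ≥0∞}

theorem lintegral_comp_smul_add_le (hh : Measurable h) {r : ℝ} (hr : 1 / 2 ≤ r) (c : E) :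
    ∫⁻ x, h (r • x + c) ≤ 2 ^ Module.finrank ℝ E * ∫⁻ x, h x := by
  have hr0 : 0 < r := by linarith
  have change_of_variables :
      ∫⁻ x, h (r • x + c) = ∫⁻ x, h (x + c) ∂(Measure.map (r • ·) volume) :=
    (lintegral_map (f := fun x => h (x + c)) (hh.comp (measurable_add_const c))
      (measurable_const_smul r)).symm
  rw [change_of_variables, Measure.map_addHaar_smul _ hr0.ne', lintegral_smul_measure,
    lintegral_add_right_eq_self, smul_eq_mul]
  gcongr
  rw [abs_of_pos (by positivity), ← inv_pow, ENNReal.ofReal_pow (by positivity)]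
  gcongr
  rw [← ENNReal.ofReal_ofNat]
  exact ENNReal.ofReal_le_ofReal ((inv_le_comm₀ hr0 two_pos).2 (by linarith))

theorem lintegral_prod_comp_add_smul_sub_le (hh : Measurable h) (Y B : Set E) (s : ℝ) :
    ∫⁻ q, h (q.2 + s • (q.1 - q.2)) ∂((volume.restrict Y).prod (volume.restrict B)) ≤
      2 ^ Module.finrank ℝ E * (volume Y + volume B) * ∫⁻ x, h x := by
  have hm : Measurable fun q : E × E => h (q.2 + s • (q.1 - q.2)) :=
    hh.comp (Continuous.measurable (by fun_prop))
  -- the endpoint whose coefficient is at least `1 / 2` is integrated first, the other one is frozen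
  rcases le_total s (1 / 2) with hs | hs
  · rw [lintegral_prod _ hm.aemeasurable]
    calc ∫⁻ y in Y, ∫⁻ b in B, h (b + s • (y - b))
        = ∫⁻ y in Y, ∫⁻ b in B, h ((1 - s) • b + s • y) := by congr! 5; module
      _ ≤ ∫⁻ _ in Y, 2 ^ Module.finrank ℝ E * ∫⁻ x, h x := by
          gcongr with y
          exact (setLIntegral_le_lintegral _ _).trans
            (lintegral_comp_smul_add_le hh (by linarith) (s • y))
      _ = 2 ^ Module.finrank ℝ E * volume Y * ∫⁻ x, h x := by rw [setLIntegral_const]; ring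
      _ ≤ _ := by gcongr; exact le_self_add
  · rw [lintegral_prod_symm _ hm.aemeasurable]
    calc ∫⁻ b in B, ∫⁻ y in Y, h (b + s • (y - b))
        = ∫⁻ b in B, ∫⁻ y in Y, h (s • y + (1 - s) • b) := by congr! 5; module
      _ ≤ ∫⁻ _ in B, 2 ^ Module.finrank ℝ E * ∫⁻ x, h x := by
          gcongr with b
          exact (setLIntegral_le_lintegral _ _).trans
            (lintegral_comp_smul_add_le hh hs ((1 - s) • b))
      _ = 2 ^ Module.finrank ℝ E * volume B * ∫⁻ x, h x := by rw [setLIntegral_const]; ring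
      _ ≤ _ := by gcongr; exact le_add_self

theorem lintegral_prod_lintegral_segment_le (hh : Measurable h) (Y B : Set E) :
    ∫⁻ q, (∫⁻ s in Icc (0 : ℝ) 1, h (q.2 + s • (q.1 - q.2)))
        ∂((volume.restrict Y).prod (volume.restrict B)) ≤
      2 ^ Module.finrank ℝ E * (volume Y + volume B) * ∫⁻ x, h x := by
  have hm : Measurable fun z : (E × E) × ℝ => h (z.1.2 + z.2 • (z.1.1 - z.1.2)) :=
    hh.comp (Continuous.measurable (by fun_prop))
  rw [lintegral_lintegral_swap hm.aemeasurable]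
  calc _ ≤ ∫⁻ _ in Icc (0 : ℝ) 1,
        2 ^ Module.finrank ℝ E * (volume Y + volume B) * ∫⁻ x, h x := by
        gcongr with s
        exact lintegral_prod_comp_add_smul_sub_le hh Y B s
    _ = _ := by simp

end Segments

variable {d : ℕ}

local notation "𝔼" d:max => EuclideanSpace ℝ (Fin d)

section Mollification

open scoped Convolution Topology
open ContinuousLinearMap (lsmul)

variable {Ω Y B : Set (𝔼 d)} {v : 𝔼 d → ℝ} {g : 𝔼 d → 𝔼 d}

/-- The mollification by `φ` of the extension of `v|_Ω` by zero. -/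
def mollify (φ : ContDiffBump (0 : 𝔼 d)) (Ω : Set (𝔼 d)) (v : 𝔼 d → ℝ) : 𝔼 d → ℝ :=
  φ.normed volume ⋆[lsmul ℝ ℝ, volume] Ω.indicator v

/-- The mollification by `φ` of the extension of `‖g‖²|_Ω` by zero. It bounds the squared gradient
of `mollify φ Ω v` when `g` is a weak gradient of `v`. -/
def mollifiedEnergy (φ : ContDiffBump (0 : 𝔼 d)) (Ω : Set (𝔼 d)) (g : 𝔼 d → 𝔼 d) (z : 𝔼 d) : ℝ≥0∞ :=
  ∫⁻ x in Ω, ENNReal.ofReal (φ.normed volume (z - x)) * ‖g x‖ₑ ^ 2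

theorem IsWeakGradient.locallyIntegrable_indicator {bc : BoundaryCondition}
    (h : IsWeakGradient bc Ω v g) (hΩ : MeasurableSet Ω) :
    LocallyIntegrable (Ω.indicator v) volume :=
  ((memLp_indicator_iff_restrict hΩ).2 h.memLp).locallyIntegrable one_le_two

theorem contDiff_mollify (φ : ContDiffBump (0 : 𝔼 d))
    (hv : LocallyIntegrable (Ω.indicator v) volume) : ContDiff ℝ 1 (mollify φ Ω v) :=
  φ.hasCompactSupport_normed.contDiff_convolution_left (n := 1) _ φ.contDiff_normed hv

theorem fderiv_mollify_apply (φ : ContDiffBump (0 : 𝔼 d))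
    (hv : LocallyIntegrable (Ω.indicator v) volume) (hΩ : MeasurableSet Ω) (z e : 𝔼 d) :
    fderiv ℝ (mollify φ Ω v) z e = ∫ x in Ω, v x * fderiv ℝ (φ.normed volume) (z - x) e := by
  have hφ : ContDiff ℝ 1 (φ.normed volume) := φ.contDiff_normed
  have hasFDerivAt := φ.hasCompactSupport_normed.hasFDerivAt_convolution_left (μ := volume)
    (lsmul ℝ ℝ) hφ hv z
  have exists_conv := ((φ.hasCompactSupport_normed (μ := volume)).fderiv ℝ).convolutionExists_left
    (μ := volume) ((lsmul ℝ ℝ).precompL _) (hφ.continuous_fderiv one_ne_zero) hv z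
  rw [mollify, hasFDerivAt.fderiv, convolution_def, ContinuousLinearMap.integral_apply exists_conv,
    ← integral_sub_left_eq_self _ volume z, ← integral_indicator hΩ]
  congr 1 with x
  by_cases hx : x ∈ Ω <;> simp [ContinuousLinearMap.precompL_apply, hx, mul_comm]

theorem isTest_neumann_normed_sub (φ : ContDiffBump (0 : 𝔼 d)) {z : 𝔼 d}
    (hz : Metric.closedBall z φ.rOut ⊆ Ω) :
    BoundaryCondition.neumann.IsTest Ω fun x => φ.normed volume (z - x) := by
  refine ⟨φ.contDiff_normed.comp (contDiff_const.sub contDiff_id),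
    φ.hasCompactSupport_normed.comp_homeomorph (Homeomorph.subLeft z),
    (closure_minimal (fun x hx => ?_) Metric.isClosed_closedBall).trans hz⟩
  have : z - x ∈ Function.support (φ.normed volume) := hx
  rw [φ.support_normed_eq, mem_ball_zero_iff, ← dist_eq_norm] at this
  exact Metric.mem_closedBall'.2 this.le

theorem IsWeakGradient.fderiv_mollify (h : IsWeakGradient .neumann Ω v g) (hΩ : MeasurableSet Ω)
    (φ : ContDiffBump (0 : 𝔼 d)) {z : 𝔼 d} (hz : Metric.closedBall z φ.rOut ⊆ Ω) (e : 𝔼 d) :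
    fderiv ℝ (mollify φ Ω v) z e = ∫ x in Ω, inner ℝ (g x) e * φ.normed volume (z - x) := by
  have hφ : ContDiff ℝ 1 (φ.normed volume) := φ.contDiff_normed
  have fderiv_reflected (x : 𝔼 d) : fderiv ℝ (fun x => φ.normed volume (z - x)) x e =
      -fderiv ℝ (φ.normed volume) (z - x) e := by
    have := ((hφ.differentiable one_ne_zero) (z - x)).hasFDerivAt.comp x
      ((hasFDerivAt_id x).const_sub z)
    simpa [Function.comp_def] using congrArg (· e) this.fderiv
  have by_parts := h.integral_eq _ (isTest_neumann_normed_sub φ hz) e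
  simp only [fderiv_reflected, mul_neg, integral_neg, neg_inj] at by_parts
  rw [fderiv_mollify_apply φ (h.locallyIntegrable_indicator hΩ) hΩ, by_parts]

theorem lintegral_ofReal_normed (φ : ContDiffBump (0 : 𝔼 d)) :
    ∫⁻ x, ENNReal.ofReal (φ.normed volume x) = 1 := by
  rw [← ofReal_integral_eq_lintegral_ofReal φ.integrable_normed (ae_of_all _ φ.nonneg_normed),
    φ.integral_normed, ENNReal.ofReal_one]

theorem IsWeakGradient.sq_enorm_fderiv_mollify_le (h : IsWeakGradient .neumann Ω v g)
    (hΩ : MeasurableSet Ω) (φ : ContDiffBump (0 : 𝔼 d)) {z : 𝔼 d}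
    (hz : Metric.closedBall z φ.rOut ⊆ Ω) (e : 𝔼 d) :
    ‖fderiv ℝ (mollify φ Ω v) z e‖ₑ ^ 2 ≤ ‖e‖ₑ ^ 2 * mollifiedEnergy φ Ω g z := by
  have hm : Measurable fun x => ENNReal.ofReal (φ.normed volume (z - x)) :=
    (φ.continuous_normed.comp (continuous_const.sub continuous_id)).measurable.ennreal_ofReal
  have hmass : ∫⁻ x in Ω, ENNReal.ofReal (φ.normed volume (z - x)) ≤ 1 := by
    refine (setLIntegral_le_lintegral _ _).trans_eq ?_
    rw [lintegral_sub_left_eq_self fun x => ENNReal.ofReal (φ.normed volume x),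
      lintegral_ofReal_normed]
  calc _ ≤ (∫⁻ x in Ω, ‖e‖ₑ * (ENNReal.ofReal (φ.normed volume (z - x)) * ‖g x‖ₑ)) ^ 2 := by
        rw [h.fderiv_mollify hΩ φ hz e]
        gcongr
        refine (enorm_integral_le_lintegral_enorm _).trans (lintegral_mono fun x => ?_)
        rw [enorm_mul, Real.enorm_of_nonneg (φ.nonneg_normed _), mul_comm (ENNReal.ofReal _),
          ← mul_assoc, mul_comm ‖e‖ₑ]
        gcongr
        simp only [enorm_eq_nnnorm]
        exact_mod_cast nnnorm_inner_le_nnnorm (𝕜 := ℝ) (g x) e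
    _ = ‖e‖ₑ ^ 2 * (∫⁻ x in Ω, ENNReal.ofReal (φ.normed volume (z - x)) * ‖g x‖ₑ) ^ 2 := by
        rw [lintegral_const_mul' _ _ enorm_ne_top, mul_pow]
    _ ≤ _ := by
        gcongr
        exact sq_lintegral_mul_le hm.aemeasurable h.memLp_grad.1.enorm hmass

theorem measurable_ofReal_normed_sub (φ : ContDiffBump (0 : 𝔼 d)) :
    Measurable fun q : 𝔼 d × 𝔼 d => ENNReal.ofReal (φ.normed volume (q.1 - q.2)) :=
  (φ.continuous_normed.comp (by fun_prop)).measurable.ennreal_ofReal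

theorem lintegral_mollifiedEnergy (hg : AEStronglyMeasurable g (volume.restrict Ω))
    (φ : ContDiffBump (0 : 𝔼 d)) :
    ∫⁻ z, mollifiedEnergy φ Ω g z = ∫⁻ x in Ω, ‖g x‖ₑ ^ 2 := by
  unfold mollifiedEnergy
  rw [lintegral_lintegral_swap]
  · refine lintegral_congr fun x => ?_
    have hm : Measurable fun z => ENNReal.ofReal (φ.normed volume (z - x)) :=
      (φ.continuous_normed.comp (continuous_id.sub continuous_const)).measurable.ennreal_ofReal
    rw [lintegral_mul_const _ hm,
      lintegral_sub_right_eq_self fun x => ENNReal.ofReal (φ.normed volume x),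
      lintegral_ofReal_normed, one_mul]
  · exact (measurable_ofReal_normed_sub φ).aemeasurable.mul
      ((hg.enorm.pow_const 2).comp_quasiMeasurePreserving Measure.quasiMeasurePreserving_snd)

theorem measurable_mollifiedEnergy (hg : AEStronglyMeasurable g (volume.restrict Ω))
    (φ : ContDiffBump (0 : 𝔼 d)) : Measurable (mollifiedEnergy φ Ω g) := by
  have eq_mk : mollifiedEnergy φ Ω g = mollifiedEnergy φ Ω (hg.mk g) := funext fun z =>
    lintegral_congr_ae (hg.ae_eq_mk.mono fun x hx => by simp only [hx])
  rw [eq_mk]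
  exact ((measurable_ofReal_normed_sub φ).mul
    ((hg.stronglyMeasurable_mk.enorm.comp measurable_snd).pow_const 2)).lintegral_prod_right'

theorem ae_mem_prod_restrict {X : Type*} [MeasurableSpace X] {μ ν : Measure X} [SFinite μ]
    [SFinite ν] {s t : Set X} (hs : MeasurableSet s) (ht : MeasurableSet t) :
    ∀ᵐ q ∂(μ.restrict s).prod (ν.restrict t), q ∈ s ×ˢ t := by
  rw [Measure.prod_restrict]
  exact ae_restrict_mem (hs.prod ht)

theorem IsWeakGradient.lintegral_sq_enorm_mollify_sub_le (h : IsWeakGradient .neumann Ω v g)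
    (hΩ : MeasurableSet Ω) (hY : MeasurableSet Y) (hB : MeasurableSet B)
    (φ : ContDiffBump (0 : 𝔼 d))
    (hφ : ∀ y ∈ Y, ∀ b ∈ B, ∀ s ∈ Icc (0 : ℝ) 1,
      Metric.closedBall (b + s • (y - b)) φ.rOut ⊆ Ω)
    {D : ℝ≥0∞} (hD : ∀ y ∈ Y, ∀ b ∈ B, ‖y - b‖ₑ ≤ D) :
    ∫⁻ q, ‖mollify φ Ω v q.1 - mollify φ Ω v q.2‖ₑ ^ 2
        ∂((volume.restrict Y).prod (volume.restrict B)) ≤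
      D ^ 2 * (2 ^ d * (volume Y + volume B)) * ∫⁻ x in Ω, ‖g x‖ₑ ^ 2 := by
  have henergy := measurable_mollifiedEnergy h.memLp_grad.1 φ
  calc _ ≤ ∫⁻ q, (∫⁻ s in Icc (0 : ℝ) 1,
          D ^ 2 * mollifiedEnergy φ Ω g (q.2 + s • (q.1 - q.2)))
        ∂((volume.restrict Y).prod (volume.restrict B)) := by
        refine lintegral_mono_ae ((ae_mem_prod_restrict hY hB).mono ?_)
        rintro ⟨y, b⟩ ⟨hy, hb⟩
        refine (sq_enorm_sub_le_lintegral_segment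
          (contDiff_mollify φ (h.locallyIntegrable_indicator hΩ)) y b).trans
          (setLIntegral_mono' measurableSet_Icc fun s hs => ?_)
        exact (h.sq_enorm_fderiv_mollify_le hΩ φ (hφ y hy b hb s hs) _).trans
          (by gcongr; exact hD y hy b hb)
    _ ≤ 2 ^ d * (volume Y + volume B) * ∫⁻ x, D ^ 2 * mollifiedEnergy φ Ω g x := by
        simpa using lintegral_prod_lintegral_segment_le (henergy.const_mul (D ^ 2)) Y B
    _ = _ := by
        rw [lintegral_const_mul _ henergy, lintegral_mollifiedEnergy h.memLp_grad.1]; ring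

theorem exists_seq_ae_tendsto_mollify (hΩ : MeasurableSet Ω)
    (hv : LocallyIntegrable (Ω.indicator v) volume) {δ : ℝ} (hδ : 0 < δ) :
    ∃ φ : ℕ → ContDiffBump (0 : 𝔼 d), (∀ n, (φ n).rOut ≤ δ) ∧
      ∀ᵐ x ∂volume.restrict Ω, Tendsto (fun n => mollify (φ n) Ω v x) atTop (𝓝 (v x)) := by
  let φ : ℕ → ContDiffBump (0 : 𝔼 d) := fun n =>
    ⟨δ / (n + 1) / 2, δ / (n + 1), by positivity, half_lt_self (by positivity)⟩
  have rOut_tendsto : Tendsto (fun n => (φ n).rOut) atTop (𝓝 0) := by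
    simpa [φ, div_eq_mul_inv] using tendsto_one_div_add_atTop_nhds_zero_nat.const_mul δ
  have hae := ContDiffBump.ae_convolution_tendsto_right_of_locallyIntegrable (K := 2) rOut_tendsto
    (Eventually.of_forall fun n => (by ring : δ / (n + 1) = 2 * (δ / (n + 1) / 2)).le) hv
  refine ⟨φ, fun n => div_le_self hδ.le (by linarith [(n.cast_nonneg : (0 : ℝ) ≤ n)]), ?_⟩
  filter_upwards [ae_restrict_of_ae hae, ae_restrict_mem hΩ] with x hx hxΩ
  rwa [indicator_of_mem hxΩ] at hx

theorem exists_forall_closedBall_segment_subset (hΩ : IsOpen Ω) (hY : IsCompact Y)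
    (hB : IsCompact B) (hYB : ∀ y ∈ Y, ∀ b ∈ B, segment ℝ b y ⊆ Ω) :
    ∃ δ > 0, ∀ y ∈ Y, ∀ b ∈ B, ∀ s ∈ Icc (0 : ℝ) 1,
      Metric.closedBall (b + s • (y - b)) δ ⊆ Ω := by
  have hK : IsCompact ((fun q : (𝔼 d × 𝔼 d) × ℝ => q.1.2 + q.2 • (q.1.1 - q.1.2)) ''
      ((Y ×ˢ B) ×ˢ Icc 0 1)) := ((hY.prod hB).prod isCompact_Icc).image (by fun_prop)
  obtain ⟨δ, hδ, hδΩ⟩ := hK.exists_cthickening_subset_open hΩ <| by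
    rintro _ ⟨⟨⟨y, b⟩, s⟩, ⟨⟨hy, hb⟩, hs⟩, rfl⟩
    exact hYB y hy b hb (segment_eq_image' ℝ b y ▸ mem_image_of_mem _ hs)
  refine ⟨δ, hδ, fun y hy b hb s hs => (Metric.closedBall_subset_cthickening ?_ δ).trans hδΩ⟩
  exact ⟨((y, b), s), ⟨⟨hy, hb⟩, hs⟩, rfl⟩

theorem IsWeakGradient.lintegral_sub_sq_le_of_isCompact (h : IsWeakGradient .neumann Ω v g)
    (hΩ : IsOpen Ω) (hY : IsCompact Y) (hB : IsCompact B)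
    (hYB : ∀ y ∈ Y, ∀ b ∈ B, segment ℝ b y ⊆ Ω) {D : ℝ≥0∞} (hD : ∀ y ∈ Y, ∀ b ∈ B, ‖y - b‖ₑ ≤ D) :
    ∫⁻ q, ‖v q.1 - v q.2‖ₑ ^ 2 ∂((volume.restrict Y).prod (volume.restrict B)) ≤
      D ^ 2 * (2 ^ d * (volume Y + volume B)) * ∫⁻ x in Ω, ‖g x‖ₑ ^ 2 := by
  obtain ⟨δ, hδ, hδΩ⟩ := exists_forall_closedBall_segment_subset hΩ hY hB hYB
  have hloc := h.locallyIntegrable_indicator hΩ.measurableSet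
  obtain ⟨φ, hφδ, hφ⟩ := exists_seq_ae_tendsto_mollify hΩ.measurableSet hloc hδ
  have hlim : ∀ᵐ q ∂(volume.restrict Y).prod (volume.restrict B),
      Tendsto (fun n => ‖mollify (φ n) Ω v q.1 - mollify (φ n) Ω v q.2‖ₑ ^ 2) atTop
        (𝓝 (‖v q.1 - v q.2‖ₑ ^ 2)) := by
    rw [ae_restrict_iff' hΩ.measurableSet] at hφ
    filter_upwards [Measure.quasiMeasurePreserving_fst.ae (ae_restrict_of_ae hφ),
      Measure.quasiMeasurePreserving_snd.ae (ae_restrict_of_ae hφ),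
      ae_mem_prod_restrict hY.measurableSet hB.measurableSet] with q hq₁ hq₂ ⟨hy, hb⟩
    have hlim₁ := hq₁ (hYB _ hy _ hb (right_mem_segment _ _ _))
    have hlim₂ := hq₂ (hYB _ hy _ hb (left_mem_segment _ _ _))
    exact ((ENNReal.continuous_pow 2).tendsto _).comp (hlim₁.sub hlim₂).enorm
  calc _ ≤ ∫⁻ q, liminf (fun n => ‖mollify (φ n) Ω v q.1 - mollify (φ n) Ω v q.2‖ₑ ^ 2) atTop
        ∂((volume.restrict Y).prod (volume.restrict B)) :=
        lintegral_mono_ae (hlim.mono fun q hq => hq.liminf_eq.ge)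
    _ ≤ liminf (fun n => ∫⁻ q, ‖mollify (φ n) Ω v q.1 - mollify (φ n) Ω v q.2‖ₑ ^ 2
        ∂((volume.restrict Y).prod (volume.restrict B))) atTop := by
        refine lintegral_liminf_le fun n => ?_
        have := (contDiff_mollify (φ n) hloc).continuous.measurable
        exact ((this.comp measurable_fst).sub (this.comp measurable_snd)).enorm.pow_const 2
    _ ≤ liminf (fun _ : ℕ => D ^ 2 * (2 ^ d * (volume Y + volume B)) * ∫⁻ x in Ω, ‖g x‖ₑ ^ 2)
        atTop := by
        refine liminf_le_liminf (Eventually.of_forall fun n => ?_)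
        exact h.lintegral_sq_enorm_mollify_sub_le hΩ.measurableSet hY.measurableSet
          hB.measurableSet (φ n) (fun y hy b hb s hs =>
            (Metric.closedBall_subset_closedBall (hφδ n)).trans (hδΩ y hy b hb s hs)) hD
    _ = _ := by simp

theorem IsWeakGradient.lintegral_sub_sq_le (h : IsWeakGradient .neumann Ω v g)
    (hΩ : IsOpen Ω) (hY : IsOpen Y) (hB : IsOpen B)
    (hYB : ∀ y ∈ Y, ∀ b ∈ B, segment ℝ b y ⊆ Ω) (hYb : Bornology.IsBounded Y)
    (hBb : Bornology.IsBounded B) {D : ℝ≥0∞} (hD : ∀ y ∈ Y, ∀ b ∈ B, ‖y - b‖ₑ ≤ D) :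
    ∫⁻ q, ‖v q.1 - v q.2‖ₑ ^ 2 ∂((volume.restrict Y).prod (volume.restrict B)) ≤
      D ^ 2 * (2 ^ d * (volume Y + volume B)) * ∫⁻ x in Ω, ‖g x‖ₑ ^ 2 := by
  obtain ⟨K, hK_closed, hK_sub, hK_union, hK_mono⟩ := hY.exists_iUnion_isClosed
  obtain ⟨K', hK'_closed, hK'_sub, hK'_union, hK'_mono⟩ := hB.exists_iUnion_isClosed
  have prod_eq_iUnion : Y ×ˢ B = ⋃ n, K n ×ˢ K' n := by
    rw [← hK_union, ← hK'_union, iUnion_prod_of_monotone hK_mono hK'_mono]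
  rw [Measure.prod_restrict, prod_eq_iUnion, setLIntegral_iUnion_of_directed _
    (Monotone.directed_le fun m n hmn => prod_mono (hK_mono hmn) (hK'_mono hmn))]
  refine iSup_le fun n => ?_
  have compact_case := h.lintegral_sub_sq_le_of_isCompact hΩ
    (Metric.isCompact_of_isClosed_isBounded (hK_closed n) (hYb.subset (hK_sub n)))
    (Metric.isCompact_of_isClosed_isBounded (hK'_closed n) (hBb.subset (hK'_sub n)))
    (fun y hy b hb => hYB y (hK_sub n hy) b (hK'_sub n hb))
    (fun y hy b hb => hD y (hK_sub n hy) b (hK'_sub n hb))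
  rw [Measure.prod_restrict] at compact_case
  exact compact_case.trans (by gcongr <;> apply_rules [hK_sub, hK'_sub])

end Mollification

section ConnectedCover

theorem induction_on_finite_open_cover {X ι : Type*} [TopologicalSpace X] [Finite ι] {S : Set X}
    (hS : IsConnected S) {U : ι → Set X} (hU : ∀ i, IsOpen (U i)) (hcover : ⋃ i, U i = S)
    {P : Set X → Prop} (hP : ∀ i, P (U i))
    (union : ∀ Y Z, IsOpen Y → IsOpen Z → Y ⊆ S → Z ⊆ S → (Y ∩ Z).Nonempty → P Y → P Z →
      P (Y ∪ Z)) : P S := by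
  have hopen (t : Set ι) : IsOpen (⋃ i ∈ t, U i) := isOpen_biUnion fun i _ => hU i
  have hsub (t : Set ι) : ⋃ i ∈ t, U i ⊆ S := iUnion₂_subset fun i _ => hcover ▸ subset_iUnion U i
  obtain ⟨x₀, hx₀⟩ := hS.nonempty
  obtain ⟨i₀, hi₀⟩ := mem_iUnion.1 (hcover.symm ▸ hx₀)
  obtain ⟨t, ⟨htne, htP⟩, hmax⟩ :=
    (toFinite {t : Set ι | (⋃ i ∈ t, U i).Nonempty ∧ P (⋃ i ∈ t, U i)}).exists_maximal
      ⟨{i₀}, by simpa using ⟨⟨x₀, hi₀⟩, hP i₀⟩⟩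
  suffices hcompl : (S ∩ ⋃ i ∈ tᶜ, U i) = ∅ by
    have hcover_t : ⋃ i ∈ t, U i = S := by
      refine (hsub t).antisymm fun x hx => ?_
      obtain ⟨i, hi⟩ := mem_iUnion.1 (hcover.symm ▸ hx)
      by_cases hit : i ∈ t
      · exact mem_biUnion hit hi
      · exact absurd (mem_inter hx (mem_biUnion hit hi)) (hcompl ▸ notMem_empty x)
    exact hcover_t ▸ htP
  by_contra hne
  obtain ⟨y, -, hyt, hyt'⟩ := hS.isPreconnected _ _ (hopen t) (hopen tᶜ)
    (by rw [← biUnion_union, union_compl_self, biUnion_univ, hcover])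
    (by rwa [inter_eq_right.2 (hsub t)]) (nonempty_iff_ne_empty.2 hne)
  obtain ⟨i, hit, hyi⟩ := mem_iUnion₂.1 hyt'
  have hinsert : ⋃ j ∈ insert i t, U j = U i ∪ ⋃ j ∈ t, U j := biUnion_insert i t U
  refine hit (hmax ⟨?_, ?_⟩ (subset_insert i t) (mem_insert i t))
  · exact hinsert ▸ ⟨y, Or.inl hyi⟩
  · exact hinsert ▸ union _ _ (hU i) (hopen t) (hcover ▸ subset_iUnion U i) (hsub t)
      ⟨y, hyi, hyt⟩ (hP i) htP

end ConnectedCover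

section SublevelSets

variable {E : Type*} [NormedAddCommGroup E] [NormedSpace ℝ E] {V : Set E} {ρ : E → ℝ} {x : E}

theorem exists_ball_fderiv_neg (hV : IsOpen V) (hx : x ∈ V) (hρ : ContDiffOn ℝ 1 ρ V)
    (hρx : fderiv ℝ ρ x ≠ 0) :
    ∃ ν : E, ∃ σ > 0, ∀ z ∈ Metric.ball x σ, z ∈ V ∧ ∀ e ∈ Metric.ball ν σ, fderiv ℝ ρ z e < 0 := by
  obtain ⟨ν, hν⟩ := LinearMap.surjective (f := (fderiv ℝ ρ x).toLinearMap)
    (fun h => hρx (ContinuousLinearMap.coe_injective h)) (-1)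
  have hcont : ContinuousAt (fun q : E × E => fderiv ℝ ρ q.1 q.2) (x, ν) := by
    have : ContinuousAt (fderiv ℝ ρ) x :=
      (hρ.continuousOn_fderiv_of_isOpen hV le_rfl).continuousAt (hV.mem_nhds hx)
    exact (ContinuousAt.comp (f := Prod.fst) (x := (x, ν)) this continuousAt_fst).clm_apply
      continuousAt_snd
  have hneg : fderiv ℝ ρ x ν < 0 := hν.trans_lt neg_one_lt_zero
  obtain ⟨σ, hσ, hball⟩ := Metric.eventually_nhds_iff_ball.1 <|
    (hcont.eventually_lt_const hneg).and (continuousAt_fst.eventually (hV.mem_nhds hx))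
  simp only [← ball_prod_same, Prod.forall, mem_prod, and_imp] at hball
  exact ⟨ν, σ, hσ, fun z hz => ⟨(hball z ν hz (Metric.mem_ball_self hσ)).2,
    fun e he => (hball z e hz he).1⟩⟩

theorem apply_add_smul_le_of_fderiv_nonpos {K : Set E} (hK : Convex ℝ K)
    (hρ : ∀ z ∈ K, DifferentiableAt ℝ ρ z) {e : E} (he : ∀ z ∈ K, fderiv ℝ ρ z e ≤ 0) {y : E}
    {s : ℝ} (hs : 0 ≤ s) (hy : y ∈ K) (hys : y + s • e ∈ K) : ρ (y + s • e) ≤ ρ y := by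
  obtain ⟨z, hz, hmvt⟩ :=
    domain_mvt (fun z hz => (hρ z hz).hasFDerivAt.hasFDerivWithinAt) hK hy hys
  rw [add_sub_cancel_left, map_smul, smul_eq_mul] at hmvt
  linarith [mul_nonpos_of_nonneg_of_nonpos hs (he z (hK.segment_subset hy hys hz))]

theorem exists_ball_direction (x ν : E) {σ : ℝ} (hσ : 0 < σ) :
    ∃ r > 0, ∃ c : E, Metric.ball x r ⊆ Metric.ball x σ ∧ Metric.ball c r ⊆ Metric.ball x σ ∧
      ∀ y ∈ Metric.ball x r, ∀ b ∈ Metric.ball c r,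
        ∃ τ : ℝ, 0 ≤ τ ∧ ∃ e ∈ Metric.ball ν σ, b - y = τ • e := by
  obtain ⟨τ, hτ, hτσ⟩ := exists_pos_mul_lt hσ (‖ν‖ + σ)
  have hτν : 0 ≤ τ * ‖ν‖ := by positivity
  have hpos : 0 < τ * σ := by positivity
  refine ⟨τ * σ / 2, by positivity, x + τ • ν, Metric.ball_subset_ball (by linarith),
    Metric.ball_subset_ball' ?_, fun y hy b hb => ⟨τ, hτ.le, τ⁻¹ • (b - y), ?_, ?_⟩⟩
  · rw [dist_self_add_left, norm_smul, Real.norm_of_nonneg hτ.le]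
    linarith
  · have hdist : ‖(b - (x + τ • ν)) - (y - x)‖ < τ * σ :=
      (norm_sub_le _ _).trans_lt (by rw [mem_ball_iff_norm] at hb hy; linarith)
    have heq : τ⁻¹ • (b - y) - ν = τ⁻¹ • ((b - (x + τ • ν)) - (y - x)) := by
      rw [show b - (x + τ • ν) - (y - x) = (b - y) - τ • ν by module, smul_sub _ _ (τ • ν),
        inv_smul_smul₀ hτ.ne']
    rw [mem_ball_iff_norm, heq, norm_smul, norm_inv, Real.norm_of_nonneg hτ.le]
    exact (inv_mul_lt_iff₀ hτ).2 hdist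
  · rw [smul_inv_smul₀ hτ.ne']

theorem exists_balls_segment_subset_sublevel (hV : IsOpen V) (hx : x ∈ V)
    (hρ : ContDiffOn ℝ 1 ρ V) (hρx : fderiv ℝ ρ x ≠ 0) :
    ∃ r > 0, ∃ c : E, ∀ y ∈ Metric.ball x r, y ∈ V ∧ (ρ y < 0 →
      ∀ b ∈ Metric.ball c r, segment ℝ b y ⊆ {z ∈ V | ρ z < 0}) := by
  obtain ⟨ν, σ, hσ, hneg⟩ := exists_ball_fderiv_neg hV hx hρ hρx
  obtain ⟨r, hr, c, hx_sub, hc_sub, hdir⟩ := exists_ball_direction x ν hσ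
  have hdiff (z) (hz : z ∈ Metric.ball x σ) : DifferentiableAt ℝ ρ z :=
    (hρ.differentiableOn one_ne_zero).differentiableAt (hV.mem_nhds (hneg z hz).1)
  refine ⟨r, hr, c, fun y hy => ⟨(hneg y (hx_sub hy)).1, fun hyneg b hb => ?_⟩⟩
  obtain ⟨τ, hτ, e, he, hbe⟩ := hdir y hy b hb
  rw [segment_symm, segment_eq_image']
  rintro _ ⟨s, hs, rfl⟩
  have hz : y + s • (b - y) ∈ Metric.ball x σ :=
    (convex_ball x σ).add_smul_sub_mem (hx_sub hy) (hc_sub hb) hs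
  refine ⟨(hneg _ hz).1, lt_of_le_of_lt ?_ hyneg⟩
  simp only [hbe, smul_smul] at hz ⊢
  exact apply_add_smul_le_of_fderiv_nonpos (convex_ball x σ) hdiff
    (fun z hz => ((hneg z hz).2 e he).le) (mul_nonneg hs.1 hτ) (hx_sub hy) hz

end SublevelSets

section Poincare

variable {Ω Y Z B : Set (𝔼 d)}

theorem sq_enorm_add_le {F : Type*} [NormedAddCommGroup F] (a b : F) :
    ‖a + b‖ₑ ^ 2 ≤ 2 * (‖a‖ₑ ^ 2 + ‖b‖ₑ ^ 2) := by
  have := ENNReal.rpow_add_le_mul_rpow_add_rpow ‖a‖ₑ ‖b‖ₑ (one_le_two : (1 : ℝ) ≤ 2)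
  rw [show (2 : ℝ) - 1 = 1 by norm_num, ENNReal.rpow_one] at this
  simp only [ENNReal.rpow_two] at this
  exact (by gcongr; exact enorm_add_le a b : ‖a + b‖ₑ ^ 2 ≤ (‖a‖ₑ + ‖b‖ₑ) ^ 2).trans this

section Constants

variable {X F : Type*} [MeasurableSpace X] {μ : Measure X} [NormedAddCommGroup F] {v : X → F}

theorem lintegral_sq_enorm_sub_const_le (v : X → F) (c c' : F) :
    ∫⁻ x, ‖v x - c‖ₑ ^ 2 ∂μ ≤ 2 * (∫⁻ x, ‖v x - c'‖ₑ ^ 2 ∂μ + ‖c' - c‖ₑ ^ 2 * μ univ) := by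
  calc ∫⁻ x, ‖v x - c‖ₑ ^ 2 ∂μ
    _ ≤ ∫⁻ x, 2 * (‖v x - c'‖ₑ ^ 2 + ‖c' - c‖ₑ ^ 2) ∂μ := lintegral_mono fun x =>
        (sub_add_sub_cancel (v x) c' c) ▸ sq_enorm_add_le (v x - c') (c' - c)
    _ = _ := by
        rw [lintegral_const_mul' _ _ ENNReal.ofNat_ne_top, lintegral_add_right _ measurable_const,
          lintegral_const]

theorem sq_enorm_sub_mul_measure_univ_le (hv : AEStronglyMeasurable v μ) (c c' : F) :
    ‖c' - c‖ₑ ^ 2 * μ univ ≤ 2 * (∫⁻ x, ‖v x - c'‖ₑ ^ 2 ∂μ + ∫⁻ x, ‖v x - c‖ₑ ^ 2 ∂μ) := by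
  calc ‖c' - c‖ₑ ^ 2 * μ univ = ∫⁻ _, ‖c' - c‖ₑ ^ 2 ∂μ := (lintegral_const _).symm
    _ ≤ ∫⁻ x, 2 * (‖v x - c'‖ₑ ^ 2 + ‖v x - c‖ₑ ^ 2) ∂μ := lintegral_mono fun x => by
        rw [← sub_add_sub_cancel c' (v x) c, ← enorm_sub_rev c' (v x)]
        exact sq_enorm_add_le _ _
    _ = _ := by
        rw [lintegral_const_mul' _ _ ENNReal.ofNat_ne_top, lintegral_add_left']
        exact ((hv.sub aestronglyMeasurable_const).enorm).pow_const 2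

end Constants

/-- The Poincaré inequality on a part `Y` of `Ω` for functions with a weak gradient in `Ω`. The
gradient is measured on all of `Ω`, which makes the inequality stable under unions. -/
def PoincareOn (Ω Y : Set (𝔼 d)) : Prop :=
  ∃ C : ℝ≥0∞, C ≠ ⊤ ∧ ∀ v g, IsWeakGradient .neumann Ω v g →
    ∃ c : ℝ, ∫⁻ x in Y, ‖v x - c‖ₑ ^ 2 ≤ C * ∫⁻ x in Ω, ‖g x‖ₑ ^ 2

theorem poincareOn_empty : PoincareOn Ω ∅ := ⟨0, ENNReal.zero_ne_top, fun _ _ _ => ⟨0, by simp⟩⟩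

theorem PoincareOn.union (hΩ : volume Ω ≠ ⊤) (hY_open : IsOpen Y) (hZ_open : IsOpen Z)
    (hYΩ : Y ⊆ Ω) (hZΩ : Z ⊆ Ω) (hYZ : (Y ∩ Z).Nonempty) (hY : PoincareOn Ω Y)
    (hZ : PoincareOn Ω Z) : PoincareOn Ω (Y ∪ Z) := by
  obtain ⟨C, hC, hY⟩ := hY
  obtain ⟨C', hC', hZ⟩ := hZ
  set κ := volume (Y ∩ Z)
  have hκ₀ : κ ≠ 0 := ((hY_open.inter hZ_open).measure_pos _ hYZ).ne'
  have hκ : κ ≠ ⊤ := measure_ne_top_of_subset (inter_subset_left.trans hYΩ) hΩ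
  have hZ_fin : volume Z ≠ ⊤ := measure_ne_top_of_subset hZΩ hΩ
  refine ⟨C + 2 * (C' + 2 * (C' + C) / κ * volume Z), by finiteness, fun v g h => ?_⟩
  obtain ⟨c, hc⟩ := hY v g h
  obtain ⟨c', hc'⟩ := hZ v g h
  set G := ∫⁻ x in Ω, ‖g x‖ₑ ^ 2
  have hdist : ‖c' - c‖ₑ ^ 2 ≤ 2 * (C' * G + C * G) / κ := by
    refine (ENNReal.le_div_iff_mul_le (.inl hκ₀) (.inl hκ)).2 ?_
    have hv : AEStronglyMeasurable v (volume.restrict (Y ∩ Z)) :=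
      h.memLp.1.mono_measure (Measure.restrict_mono_set _ (inter_subset_left.trans hYΩ))
    refine (Measure.restrict_apply_univ (μ := volume) (Y ∩ Z) ▸
      sq_enorm_sub_mul_measure_univ_le hv c c').trans ?_
    gcongr
    · exact (lintegral_mono_set inter_subset_right).trans hc'
    · exact (lintegral_mono_set inter_subset_left).trans hc
  refine ⟨c, (lintegral_union_le _ _ _).trans ?_⟩
  calc (∫⁻ x in Y, ‖v x - c‖ₑ ^ 2) + ∫⁻ x in Z, ‖v x - c‖ₑ ^ 2
    _ ≤ C * G + 2 * (C' * G + 2 * (C' * G + C * G) / κ * volume Z) := by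
        refine add_le_add hc ((lintegral_sq_enorm_sub_const_le v c c').trans ?_)
        rw [Measure.restrict_apply_univ]
        gcongr
    _ = _ := by
        simp only [div_eq_mul_inv]
        ring

theorem poincareOn_of_segment (hΩ : IsOpen Ω) (hY : IsOpen Y) (hB : IsOpen B) (hB₀ : B.Nonempty)
    (hYB : ∀ y ∈ Y, ∀ b ∈ B, segment ℝ b y ⊆ Ω) (hYb : Bornology.IsBounded Y)
    (hBb : Bornology.IsBounded B) : PoincareOn Ω Y := by
  rcases Y.eq_empty_or_nonempty with rfl | ⟨y₀, hy₀⟩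
  · exact poincareOn_empty
  obtain ⟨b₀, hb₀⟩ := hB₀
  have hYΩ : Y ⊆ Ω := fun y hy => hYB y hy b₀ hb₀ (right_mem_segment _ _ _)
  have hBΩ : B ⊆ Ω := fun b hb => hYB y₀ hy₀ b hb (left_mem_segment _ _ _)
  obtain ⟨D, hD⟩ := Metric.isBounded_iff.1 (hYb.union hBb)
  have hdist (y) (hy : y ∈ Y) (b) (hb : b ∈ B) : ‖y - b‖ₑ ≤ ENNReal.ofReal D := by
    rw [← edist_eq_enorm_sub, edist_dist]
    exact ENNReal.ofReal_le_ofReal (hD (Or.inl hy) (Or.inr hb))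
  have hB_vol : volume B ≠ 0 := (hB.measure_pos _ ⟨b₀, hb₀⟩).ne'
  have hB_fin : volume B ≠ ⊤ := hBb.measure_lt_top.ne
  have hY_fin : volume Y ≠ ⊤ := hYb.measure_lt_top.ne
  refine ⟨(volume B)⁻¹ * (ENNReal.ofReal D ^ 2 * (2 ^ d * (volume Y + volume B))), by finiteness,
    fun v g h => ?_⟩
  have hmeas : AEMeasurable (fun q : 𝔼 d × 𝔼 d => ‖v q.1 - v q.2‖ₑ ^ 2)
      ((volume.restrict Y).prod (volume.restrict B)) := by
    have hv := h.memLp.1.aemeasurable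
    exact ((hv.mono_set hYΩ).comp_fst.sub (hv.mono_set hBΩ).comp_snd).enorm.pow_const 2
  have hprod := h.lintegral_sub_sq_le hΩ hY hB hYB hYb hBb hdist
  rw [lintegral_prod_symm _ hmeas] at hprod
  -- The constant is the value of `v` at a point `b` that is no worse than the average over `B`.
  obtain ⟨b, -, hb⟩ := exists_le_setLAverage hB_vol hB_fin hmeas.lintegral_prod_left'
  refine ⟨v b, hb.trans ?_⟩
  rw [setLAverage_eq, ENNReal.div_eq_inv_mul, mul_assoc]
  gcongr

theorem poincareOn_of_convex (hΩ : IsOpen Ω) (hY : IsOpen Y) (hYc : Convex ℝ Y)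
    (hYb : Bornology.IsBounded Y) (hYΩ : Y ⊆ Ω) : PoincareOn Ω Y := by
  rcases Y.eq_empty_or_nonempty with rfl | hne
  · exact poincareOn_empty
  exact poincareOn_of_segment hΩ hY hY hne
    (fun y hy b hb => (hYc.segment_subset hb hy).trans hYΩ) hYb hYb

theorem exists_poincareOn_inter_of_fderiv_ne_zero (hΩ : IsOpen Ω) {V : Set (𝔼 d)} {ρ : 𝔼 d → ℝ}
    {x : 𝔼 d} (hV : IsOpen V) (hx : x ∈ V) (hρ : ContDiffOn ℝ 1 ρ V) (hρx : fderiv ℝ ρ x ≠ 0)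
    (hΩV : Ω ∩ V = {y ∈ V | ρ y < 0}) : ∃ U, IsOpen U ∧ x ∈ U ∧ PoincareOn Ω (Ω ∩ U) := by
  obtain ⟨r, hr, c, hseg⟩ := exists_balls_segment_subset_sublevel hV hx hρ hρx
  refine ⟨Metric.ball x r, Metric.isOpen_ball, Metric.mem_ball_self hr,
    poincareOn_of_segment hΩ (hΩ.inter Metric.isOpen_ball) (Metric.isOpen_ball (x := c))
      (Metric.nonempty_ball.2 hr) ?_ (Metric.isBounded_ball.subset inter_subset_right)
      Metric.isBounded_ball⟩
  rintro y ⟨hyΩ, hy⟩ b hb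
  obtain ⟨hyV, hsub⟩ := hseg y hy
  have hy_neg : y ∈ {y ∈ V | ρ y < 0} := hΩV ▸ ⟨hyΩ, hyV⟩
  exact (hΩV ▸ hsub hy_neg.2 b hb).trans inter_subset_left

theorem exists_poincareOn_inter_of_mem_closure (hΩ : IsOpen Ω) (hC1 : HasC1Boundary Ω) {x : 𝔼 d}
    (hx : x ∈ closure Ω) : ∃ U, IsOpen U ∧ x ∈ U ∧ PoincareOn Ω (Ω ∩ U) := by
  by_cases hxΩ : x ∈ Ω
  · obtain ⟨r, hr, hball⟩ := Metric.isOpen_iff.1 hΩ x hxΩ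
    refine ⟨Metric.ball x r, Metric.isOpen_ball, Metric.mem_ball_self hr, ?_⟩
    rw [inter_eq_right.2 hball]
    exact poincareOn_of_convex hΩ Metric.isOpen_ball (convex_ball x r) Metric.isBounded_ball hball
  · obtain ⟨V, ρ, hV, hxV, hρ, hρx, hΩV⟩ := hC1 x ⟨hx, by rwa [hΩ.interior_eq]⟩
    exact exists_poincareOn_inter_of_fderiv_ne_zero hΩ hV hxV hρ hρx hΩV

theorem poincareOn_of_hasC1Boundary (hΩ : IsOpen Ω) (hc : IsConnected Ω)
    (hb : Bornology.IsBounded Ω) (hC1 : HasC1Boundary Ω) : PoincareOn Ω Ω := by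
  choose! U hU hxU hP using fun x hx => exists_poincareOn_inter_of_mem_closure hΩ hC1 (x := x) hx
  obtain ⟨s, hs, hs_cover⟩ := hb.isCompact_closure.elim_nhds_subcover U
    fun x hx => (hU x hx).mem_nhds (hxU x hx)
  refine induction_on_finite_open_cover (ι := s) hc (U := fun x => Ω ∩ U x)
    (fun x => hΩ.inter (hU x (hs x x.2))) ?_ (fun x => hP x (hs x x.2))
    fun Y Z => PoincareOn.union hb.measure_lt_top.ne
  rw [← inter_iUnion, inter_eq_left, iUnion_subtype]
  exact subset_closure.trans hs_cover

end Poincare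

section Domain

variable {bc : BoundaryCondition} {Ω : Set (𝔼 d)} {L : ℝ}

/-- The open cube `(0, L)^d`. -/
def cube (d : ℕ) (L : ℝ) : Set (𝔼 d) := {x | ∀ i, x i ∈ Ioo 0 L}

theorem cube_eq_preimage (d : ℕ) (L : ℝ) :
    cube d L = (WithLp.ofLp : 𝔼 d → Fin d → ℝ) ⁻¹' univ.pi fun _ => Ioo 0 L := by
  ext x
  simp [cube]

theorem isOpen_cube (d : ℕ) (L : ℝ) : IsOpen (cube d L) :=
  cube_eq_preimage d L ▸
    (isOpen_set_pi finite_univ fun _ _ => isOpen_Ioo).preimage (PiLp.continuous_ofLp 2 _)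

theorem isBounded_cube (d : ℕ) (L : ℝ) : Bornology.IsBounded (cube d L) :=
  cube_eq_preimage d L ▸ (PiLp.antilipschitzWith_ofLp 2 fun _ : Fin d => ℝ).isBounded_preimage
    (Bornology.IsBounded.pi fun _ => Metric.isBounded_Ioo 0 L)

theorem convex_cube (d : ℕ) (L : ℝ) : Convex ℝ (cube d L) :=
  cube_eq_preimage d L ▸ (convex_pi fun _ _ => convex_Ioo 0 L).linear_preimage
    (WithLp.linearEquiv 2 ℝ (Fin d → ℝ)).toLinearMap

/-- `BoundaryCondition.Admissible` without connectedness and boundary regularity, which are needed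
for the Poincaré inequality only. -/
def BoundaryCondition.IsBoundedDomain (Ω : Set (𝔼 d)) : BoundaryCondition → Prop
  | .neumann => IsOpen Ω ∧ Ω.Nonempty ∧ Bornology.IsBounded Ω
  | .periodic L => 0 < L ∧ Ω = cube d L

theorem BoundaryCondition.Admissible.isBoundedDomain (h : bc.Admissible Ω) :
    bc.IsBoundedDomain Ω := by
  cases bc with
  | neumann => exact ⟨h.1, h.2.1.nonempty, h.2.2.1⟩
  | periodic L => exact h

theorem BoundaryCondition.IsBoundedDomain.isOpen (h : bc.IsBoundedDomain Ω) : IsOpen Ω := by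
  cases bc with
  | neumann => exact h.1
  | periodic L => exact h.2 ▸ isOpen_cube d L

theorem BoundaryCondition.IsBoundedDomain.isBounded (h : bc.IsBoundedDomain Ω) :
    Bornology.IsBounded Ω := by
  cases bc with
  | neumann => exact h.2.2
  | periodic L => exact h.2 ▸ isBounded_cube d L

theorem BoundaryCondition.IsBoundedDomain.isFiniteMeasure (h : bc.IsBoundedDomain Ω) :
    IsFiniteMeasure (volume.restrict Ω) :=
  isFiniteMeasure_restrict.2 h.isBounded.measure_lt_top.ne

end Domain

section TestFunctions

variable {bc : BoundaryCondition} {Ω : Set (𝔼 d)} {L : ℝ}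

theorem setIntegral_Icc_fderiv_eq_zero_of_periodic (hL : 0 ≤ L) {ψ : (Fin d → ℝ) → ℝ}
    (hψ : ContDiff ℝ 1 ψ) (hper : ∀ z i, ψ (z + Pi.single i L) = ψ z) (y : Fin d → ℝ) :
    ∫ z in Icc 0 (fun _ => L), fderiv ℝ ψ z y = 0 := by
  cases d with
  | zero => simp only [Subsingleton.elim y 0, map_zero, integral_zero]
  | succ n =>
    have hsum (z) : ∑ i, (y i • fderiv ℝ ψ z) (Pi.single i 1) = fderiv ℝ ψ z y := by
      conv_rhs => rw [pi_eq_sum_univ' y]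
      simp
    have hdiv := integral_divergence_of_hasFDerivAt_off_countable' (a := 0) (b := fun _ => L)
      (fun _ => hL) (fun i z => y i • ψ z) (fun i z => y i • fderiv ℝ ψ z) ∅ countable_empty
      (fun i => (hψ.continuous.const_smul (y i)).continuousOn)
      (fun z _ i => ((hψ.differentiable one_ne_zero) z).hasFDerivAt.const_smul (y i))
      (by
        simp_rw [hsum]
        exact ((hψ.continuous_fderiv one_ne_zero).clm_apply continuous_const).integrableOn_Icc)
    simp_rw [hsum] at hdiv
    refine hdiv.trans (Finset.sum_eq_zero fun i _ => sub_eq_zero.2 ?_)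
    -- Opposite faces contribute equally.
    have hface (z : Fin n → ℝ) : i.insertNth (α := fun _ => ℝ) L z =
        i.insertNth (α := fun _ => ℝ) 0 z + Pi.single i L := by
      ext j
      refine Fin.succAboveCases i ?_ (fun j => ?_) j <;> simp
    simp only [hface, hper, Pi.zero_apply]

theorem setIntegral_cube_fderiv_eq_zero_of_periodic (hL : 0 ≤ L) {φ : 𝔼 d → ℝ}
    (hφ : ContDiff ℝ 1 φ) (hper : ∀ x i, φ (x + EuclideanSpace.single i L) = φ x) (y : 𝔼 d) :
    ∫ x in cube d L, fderiv ℝ φ x y = 0 := by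
  set T : (Fin d → ℝ) →L[ℝ] 𝔼 d := (EuclideanSpace.equiv (Fin d) ℝ).symm.toContinuousLinearMap
  have hfderiv (z : Fin d → ℝ) : fderiv ℝ (φ ∘ T) z (WithLp.ofLp y) = fderiv ℝ φ (T z) y := by
    rw [fderiv_comp z (hφ.differentiable one_ne_zero _) T.differentiableAt, T.fderiv]
    rfl
  have hzero := setIntegral_Icc_fderiv_eq_zero_of_periodic hL (hφ.comp T.contDiff)
    (fun z i => (congrArg φ (map_add T z _)).trans (hper (T z) i)) (WithLp.ofLp y)
  simp only [hfderiv] at hzero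
  have hae : (univ.pi fun _ : Fin d => Ioo 0 L) =ᵐ[volume] Icc 0 fun _ => L :=
    volume_pi (α := fun _ : Fin d => ℝ) ▸ Measure.univ_pi_Ioo_ae_eq_Icc
  rw [← hzero, ← setIntegral_congr_set hae, cube_eq_preimage]
  have hpres := EuclideanSpace.volume_preserving_symm_measurableEquiv_toLp (Fin d)
  exact hpres.setIntegral_preimage_emb (MeasurableEquiv.toLp 2 (Fin d → ℝ)).symm.measurableEmbedding
    (fun z => fderiv ℝ φ (T z) y) _

theorem setIntegral_fderiv_eq_zero_of_tsupport_subset {φ : 𝔼 d → ℝ} (hφ : ContDiff ℝ 1 φ)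
    (hc : HasCompactSupport φ) (hsupp : tsupport φ ⊆ Ω) (y : 𝔼 d) :
    ∫ x in Ω, fderiv ℝ φ x y = 0 := by
  have hcont : Continuous fun x => fderiv ℝ φ x y :=
    (hφ.continuous_fderiv one_ne_zero).clm_apply continuous_const
  have hzero (x) (hx : x ∉ Ω) : fderiv ℝ φ x y = 0 :=
    image_eq_zero_of_notMem_tsupport (f := fun x => fderiv ℝ φ x y) fun h =>
      hx (hsupp (tsupport_fderiv_apply_subset ℝ y h))
  rw [setIntegral_eq_integral_of_forall_compl_eq_zero hzero]
  have := integral_mul_fderiv_eq_neg_fderiv_mul_of_integrable (μ := volume) (f := fun _ => (1 : ℝ))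
    (g := φ) (v := y) (by simp)
    (by simpa using hcont.integrable_of_hasCompactSupport (hc.fderiv_apply ℝ y))
    (by simpa using hφ.continuous.integrable_of_hasCompactSupport hc)
    (fun x _ => by fun_prop) (fun x _ => (hφ.differentiable one_ne_zero) x)
  simpa using this

theorem BoundaryCondition.IsTest.setIntegral_fderiv_eq_zero (hΩ : bc.IsBoundedDomain Ω)
    {φ : 𝔼 d → ℝ} (hφ : bc.IsTest Ω φ) (y : 𝔼 d) : ∫ x in Ω, fderiv ℝ φ x y = 0 := by
  cases bc with
  | neumann =>
    exact setIntegral_fderiv_eq_zero_of_tsupport_subset (hφ.1.of_le (by simp)) hφ.2.1 hφ.2.2 y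
  | periodic L =>
    obtain ⟨hL, rfl⟩ := hΩ
    exact setIntegral_cube_fderiv_eq_zero_of_periodic hL.le (hφ.1.of_le (by simp)) hφ.2 y

theorem isWeakGradient_const (hΩ : bc.IsBoundedDomain Ω) (c : ℝ) :
    IsWeakGradient bc Ω (fun _ => c) 0 := by
  have := hΩ.isFiniteMeasure
  refine ⟨memLp_const c, MemLp.zero, fun φ hφ y => ?_⟩
  rw [integral_const_mul, hφ.setIntegral_fderiv_eq_zero hΩ]
  simp

end TestFunctions

section Periodization

open scoped Topology

variable {bc : BoundaryCondition} {Ω : Set (𝔼 d)} {L : ℝ} {φ : 𝔼 d → ℝ}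

/-- The vector `L k` for an integer vector `k`. -/
def latticeVec (L : ℝ) (k : Fin d → ℤ) : 𝔼 d := WithLp.toLp 2 fun i => L * k i

/-- The sum of all translates of `φ` by vectors of the lattice `L ℤ^d`. -/
def periodize (L : ℝ) (φ : 𝔼 d → ℝ) (x : 𝔼 d) : ℝ := ∑ᶠ k : Fin d → ℤ, φ (x + latticeVec L k)

theorem periodize_add_single (L : ℝ) (φ : 𝔼 d → ℝ) (x : 𝔼 d) (i : Fin d) :
    periodize L φ (x + EuclideanSpace.single i L) = periodize L φ x := by
  have hshift (k : Fin d → ℤ) : x + EuclideanSpace.single i L + latticeVec L k =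
      x + latticeVec L (k + Pi.single i 1) := by
    ext j
    rcases eq_or_ne j i with rfl | hj
    · simp [latticeVec, mul_add, add_comm, add_left_comm]
    · simp [latticeVec, hj]
  simp only [periodize, hshift]
  exact finsum_comp_equiv (Equiv.addRight (Pi.single i 1)) (f := fun k => φ (x + latticeVec L k))

theorem mem_Icc_of_add_mul_mem_Ioo (hL : 0 < L) {N : ℕ} {x : ℝ}
    (hx : x ∈ Ioo (-(L * N)) (L * (N + 1))) {k : ℤ} (hk : x + L * k ∈ Ioo 0 L) :
    k ∈ Finset.Icc (-N : ℤ) N := by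
  have hlower : (-(N + 1) : ℝ) < k := by
    refine lt_of_mul_lt_mul_left ?_ hL.le
    linarith [hx.2, hk.1]
  have hupper : (k : ℝ) < N + 1 := by
    refine lt_of_mul_lt_mul_left ?_ hL.le
    linarith [hx.1, hk.2]
  rw [Finset.mem_Icc]
  constructor
  · have : -(N + 1 : ℤ) < k := by exact_mod_cast hlower
    lia
  · exact Int.lt_add_one_iff.1 (by exact_mod_cast hupper)

theorem periodize_eq_sum (hL : 0 < L) (hsupp : tsupport φ ⊆ cube d L) {N : ℕ} {x : 𝔼 d}
    (hx : ∀ i, x i ∈ Ioo (-(L * N)) (L * (N + 1))) :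
    periodize L φ x =
      ∑ k ∈ Fintype.piFinset fun _ => Finset.Icc (-N : ℤ) N, φ (x + latticeVec L k) :=
  finsum_eq_sum_of_support_subset _ fun _ hk => Finset.mem_coe.2 <| Fintype.mem_piFinset.2 fun i =>
    mem_Icc_of_add_mul_mem_Ioo hL (hx i) (hsupp (subset_tsupport _ hk) i)

theorem contDiff_periodize (hL : 0 < L) (hφ : ContDiff ℝ ∞ φ) (hsupp : tsupport φ ⊆ cube d L) :
    ContDiff ℝ ∞ (periodize L φ) := by
  rw [contDiff_iff_contDiffAt]
  intro x₀
  obtain ⟨N, hN⟩ := exists_nat_gt ((‖x₀‖ + 1) / L)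
  rw [div_lt_iff₀' hL] at hN
  have hsum : periodize L φ =ᶠ[𝓝 x₀] fun x =>
      ∑ k ∈ Fintype.piFinset fun _ => Finset.Icc (-N : ℤ) N, φ (x + latticeVec L k) := by
    filter_upwards [Metric.ball_mem_nhds x₀ one_pos] with x hx
    refine periodize_eq_sum hL hsupp fun i => ?_
    have hxi : |x i| < L * N :=
      calc |x i| ≤ ‖x‖ := PiLp.norm_apply_le x i
        _ ≤ ‖x₀‖ + ‖x - x₀‖ := norm_le_norm_add_norm_sub' x x₀
        _ < L * N := by linarith [mem_ball_iff_norm.1 hx]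
    exact ⟨(abs_lt.1 hxi).1, by linarith [(abs_lt.1 hxi).2]⟩
  exact (ContDiffAt.sum fun k _ => (hφ.comp (contDiff_id.add contDiff_const)).contDiffAt)
    |>.congr_of_eventuallyEq hsum

theorem eqOn_periodize (hL : 0 < L) (hsupp : tsupport φ ⊆ cube d L) :
    EqOn (periodize L φ) φ (cube d L) := fun x hx => by
  have hzero : latticeVec L (0 : Fin d → ℤ) = 0 := by
    ext i
    simp [latticeVec]
  rw [periodize_eq_sum (N := 0) hL hsupp (by simpa [cube] using hx)]
  have hsingle : Fintype.piFinset (fun _ : Fin d => Finset.Icc (-(0 : ℕ) : ℤ) (0 : ℕ)) = {0} := by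
    simp [← Pi.zero_def]
  rw [hsingle, Finset.sum_singleton, hzero, add_zero]

theorem IsWeakGradient.toNeumann (hΩ : bc.IsBoundedDomain Ω) {v : 𝔼 d → ℝ} {g : 𝔼 d → 𝔼 d}
    (h : IsWeakGradient bc Ω v g) : IsWeakGradient .neumann Ω v g := by
  cases bc with
  | neumann => exact h
  | periodic L =>
    refine ⟨h.memLp, h.memLp_grad, ?_⟩
    rintro φ ⟨hφ, -, hsupp⟩ y
    obtain ⟨hL, rfl⟩ := hΩ
    have heq := eqOn_periodize hL hsupp
    have hcube := isOpen_cube d L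
    have hfderiv : EqOn (fderiv ℝ (periodize L φ)) (fderiv ℝ φ) (cube d L) := fun x hx =>
      (heq.eventuallyEq_of_mem (hcube.mem_nhds hx)).fderiv_eq
    have hperiodize := h.integral_eq (periodize L φ)
      ⟨contDiff_periodize hL hφ hsupp, periodize_add_single L φ⟩ y
    rwa [setIntegral_congr_fun hcube.measurableSet fun x hx => (by rw [hfderiv hx]),
      setIntegral_congr_fun hcube.measurableSet fun x hx =>
        congrArg (inner ℝ (g x) y * ·) (heq hx)] at hperiodize

end Periodization

theorem BoundaryCondition.Admissible.poincareOn {bc : BoundaryCondition} {Ω : Set (𝔼 d)}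
    (h : bc.Admissible Ω) : PoincareOn Ω Ω := by
  cases bc with
  | neumann => exact poincareOn_of_hasC1Boundary h.1 h.2.1 h.2.2.1 h.2.2.2
  | periodic L =>
    obtain ⟨-, rfl⟩ := h
    exact poincareOn_of_convex (isOpen_cube d L) (isOpen_cube d L) (convex_cube d L)
      (isBounded_cube d L) subset_rfl

section DualSeminorm

variable {V : Type*} [AddCommGroup V] [Module ℝ V] {B : LinearMap.BilinForm ℝ V}
  {ℓ₀ ℓ₁ : V →ₗ[ℝ] ℝ} {S : ℝ}

theorem two_mul_sub_le_of_sq_le_mul (hB : B.IsNonneg) (hS : 0 ≤ S) {χ : V}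
    (h : ℓ₀ χ ^ 2 ≤ S * B χ χ) : 2 * ℓ₀ χ - B χ χ ≤ S := by
  have hb := hB.nonneg χ
  have : 2 * ℓ₀ χ ≤ S + B χ χ :=
    le_of_abs_le (abs_le_of_sq_le_sq (by nlinarith [sq_nonneg (S - B χ χ)]) (by positivity))
  linarith

theorem sq_le_mul_of_forall_two_mul_sub_le (h : ∀ χ, 2 * ℓ₀ χ - B χ χ ≤ S) (χ : V) :
    ℓ₀ χ ^ 2 ≤ S * B χ χ := by
  have hdiscrim : discrim (B χ χ) (-2 * ℓ₀ χ) S ≤ 0 := discrim_le_zero fun s => by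
    have := h (s • χ)
    simp only [map_smul, LinearMap.smul_apply, smul_eq_mul] at this
    linarith
  rw [discrim] at hdiscrim
  linarith

theorem sq_le_sub_mul_of_add_mul_eq (hB : B.IsPosSemidef) (hS : 0 ≤ S) {k : ℝ} {w : V}
    (hℓ : ∀ χ, ℓ₁ χ + k * B w χ = ℓ₀ χ) (h₀ : ∀ χ, ℓ₀ χ ^ 2 ≤ S * B χ χ) :
    0 ≤ S - 2 * k * ℓ₁ w ∧ ∀ χ, ℓ₁ χ ^ 2 ≤ (S - 2 * k * ℓ₁ w) * B χ χ := by
  have hconj (χ : V) : 2 * ℓ₁ χ - B χ χ ≤ S - 2 * k * ℓ₁ w := by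
    -- The choice of the direction `w` makes the mixed terms `2 k B(w, χ)` cancel.
    have hshift := two_mul_sub_le_of_sq_le_mul hB.isNonneg hS (h₀ (χ + k • w))
    have hsymm : B χ w = B w χ := hB.isSymm.eq χ w
    simp only [← hℓ, map_add, map_smul, LinearMap.add_apply, LinearMap.smul_apply, smul_eq_mul,
      hsymm] at hshift
    nlinarith [mul_nonneg (sq_nonneg k) (hB.isNonneg.nonneg w)]
  exact ⟨by simpa using hconj 0, sq_le_mul_of_forall_two_mul_sub_le hconj⟩

end DualSeminorm

section EnergySpace

variable {bc : BoundaryCondition} {Ω : Set (𝔼 d)} {v h χ : 𝔼 d → ℝ} {g G : 𝔼 d → 𝔼 d}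

theorem BoundaryCondition.IsTest.contDiff (h : bc.IsTest Ω v) : ContDiff ℝ ∞ v := by
  cases bc <;> exact h.1

/-- The space `Ḣ¹`, with each function paired with its weak gradients so that the gradient becomes
a linear map. -/
def weakGradients (hΩ : bc.IsBoundedDomain Ω) : Submodule ℝ ((𝔼 d → ℝ) × (𝔼 d → 𝔼 d)) where
  carrier := {q | IsWeakGradient bc Ω q.1 q.2}
  zero_mem' := ⟨MemLp.zero, MemLp.zero, fun φ _ y => by simp⟩
  add_mem' := by
    rintro ⟨v, g⟩ ⟨w, h⟩ hv hw
    have := hΩ.isFiniteMeasure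
    refine ⟨hv.memLp.add hw.memLp, hv.memLp_grad.add hw.memLp_grad, fun φ hφ y => ?_⟩
    have hmul {v ψ : 𝔼 d → ℝ} (hv : IntegrableOn v Ω) (hψ : Continuous ψ) :
        IntegrableOn (fun x => v x * ψ x) Ω :=
      hv.mul_continuousOn_of_subset hψ.continuousOn hΩ.isOpen.measurableSet
        hΩ.isBounded.isCompact_closure subset_closure
    have hderiv : Continuous fun x => fderiv ℝ φ x y :=
      (hφ.contDiff.continuous_fderiv (by simp)).clm_apply continuous_const
    have hfun {v g} (h : IsWeakGradient bc Ω v g) :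
        IntegrableOn (fun x => v x * fderiv ℝ φ x y) Ω :=
      hmul (h.memLp.integrable one_le_two) hderiv
    have hgrad {v g} (h : IsWeakGradient bc Ω v g) :
        IntegrableOn (fun x => inner ℝ (g x) y * φ x) Ω :=
      hmul ((h.memLp_grad.integrable one_le_two).inner_const y) hφ.contDiff.continuous
    simp only [Prod.mk_add_mk, Pi.add_apply, add_mul, inner_add_left]
    rw [integral_add (hfun hv) (hfun hw), integral_add (hgrad hv) (hgrad hw),
      hv.integral_eq φ hφ y, hw.integral_eq φ hφ y, neg_add]
  smul_mem' := by
    rintro c ⟨v, g⟩ hv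
    refine ⟨hv.memLp.const_smul c, hv.memLp_grad.const_smul c, fun φ hφ y => ?_⟩
    simp only [Prod.smul_mk, Pi.smul_apply, smul_eq_mul, real_inner_smul_left, mul_assoc,
      integral_const_mul]
    rw [hv.integral_eq φ hφ y, mul_neg]

theorem IsWeakGradient.sub_const (hΩ : bc.IsBoundedDomain Ω) (h : IsWeakGradient bc Ω v g)
    (c : ℝ) : IsWeakGradient bc Ω (fun x => v x - c) g := by
  have hsub := (weakGradients hΩ).sub_mem (x := (v, g)) (y := (fun _ => c, 0)) h
    (isWeakGradient_const hΩ c)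
  rwa [Prod.mk_sub_mk, sub_zero] at hsub

section L2

variable {X F : Type*} [MeasurableSpace X] {μ : Measure X} [NormedAddCommGroup F]
  [InnerProductSpace ℝ F] {f g : X → F}

theorem inner_toLp_toLp (hf : MemLp f 2 μ) (hg : MemLp g 2 μ) :
    inner ℝ hf.toLp hg.toLp = ∫ x, inner ℝ (f x) (g x) ∂μ := by
  refine integral_congr_ae ?_
  filter_upwards [hf.coeFn_toLp, hg.coeFn_toLp] with x hfx hgx
  rw [hfx, hgx]

theorem eLpNorm_two_eq_ofReal_sqrt (hf : MemLp f 2 μ) :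
    eLpNorm f 2 μ = ENNReal.ofReal √(∫ x, inner ℝ (f x) (f x) ∂μ) := by
  rw [← inner_toLp_toLp hf hf, ← norm_eq_sqrt_real_inner, Lp.norm_toLp,
    ENNReal.ofReal_toReal hf.eLpNorm_ne_top]

end L2

/-- The functional `χ ↦ (v, χ)` on `Ḣ¹`. -/
def pairing (hΩ : bc.IsBoundedDomain Ω) (hv : MemLp v 2 (volume.restrict Ω)) :
    weakGradients hΩ →ₗ[ℝ] ℝ where
  toFun q := inner ℝ hv.toLp q.2.memLp.toLp
  map_add' q r := inner_add_right _ q.2.memLp.toLp r.2.memLp.toLp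
  map_smul' c q := real_inner_smul_right _ q.2.memLp.toLp c

theorem pairing_apply (hΩ : bc.IsBoundedDomain Ω) (hv : MemLp v 2 (volume.restrict Ω))
    (q : weakGradients hΩ) : pairing hΩ hv q = ∫ x in Ω, v x * q.1.1 x :=
  (inner_toLp_toLp hv q.2.memLp).trans (by simp only [RCLike.inner_apply, conj_trivial, mul_comm])

/-- The form `(∇v, ∇χ)` on `Ḣ¹`; `hNegOneNorm` of `v` is the norm of the functional `(v, ·)` dual to
its seminorm. -/
def dirichletForm (hΩ : bc.IsBoundedDomain Ω) : LinearMap.BilinForm ℝ (weakGradients hΩ) :=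
  let grad : weakGradients hΩ →ₗ[ℝ] Lp (𝔼 d) 2 (volume.restrict Ω) :=
    { toFun q := q.2.memLp_grad.toLp
      map_add' _ _ := rfl
      map_smul' _ _ := rfl }
  (innerₗ _).compl₁₂ grad grad

theorem dirichletForm_apply (hΩ : bc.IsBoundedDomain Ω) (q r : weakGradients hΩ) :
    dirichletForm hΩ q r = ∫ x in Ω, inner ℝ (q.1.2 x) (r.1.2 x) :=
  inner_toLp_toLp q.2.memLp_grad r.2.memLp_grad

theorem isPosSemidef_dirichletForm (hΩ : bc.IsBoundedDomain Ω) :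
    (dirichletForm hΩ).IsPosSemidef :=
  ⟨⟨fun q r => real_inner_comm r.2.memLp_grad.toLp q.2.memLp_grad.toLp⟩,
    ⟨fun q => real_inner_self_nonneg (x := q.2.memLp_grad.toLp)⟩⟩

theorem hNegOneNorm_le_ofReal_iff {r : ℝ} (hr : 0 ≤ r) : hNegOneNorm bc Ω v ≤ ENNReal.ofReal r ↔
    ∀ χ G, IsWeakGradient bc Ω χ G →
      (∫ x in Ω, v x * χ x) ^ 2 ≤ r ^ 2 * ∫ x in Ω, inner ℝ (G x) (G x) := by
  simp only [hNegOneNorm, iSup_le_iff]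
  refine forall₃_congr fun χ G hG => ?_
  rw [ENNReal.div_le_iff_le_mul (.inr ENNReal.ofReal_ne_top) (.inl hG.memLp_grad.eLpNorm_ne_top),
    eLpNorm_two_eq_ofReal_sqrt hG.memLp_grad, ← ENNReal.ofReal_mul hr,
    ENNReal.ofReal_le_ofReal_iff (by positivity), ← Real.sqrt_sq hr,
    ← Real.sqrt_mul (sq_nonneg r), ← Real.sqrt_sq_eq_abs, Real.sqrt_sq hr,
    Real.sqrt_le_sqrt_iff (mul_nonneg (sq_nonneg r)
      (integral_nonneg fun _ => real_inner_self_nonneg))]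

theorem sq_integral_mul_le (hv : hNegOneNorm bc Ω v ≠ ⊤) (hG : IsWeakGradient bc Ω χ G) :
    (∫ x in Ω, v x * χ x) ^ 2 ≤
      (hNegOneNorm bc Ω v).toReal ^ 2 * ∫ x in Ω, inner ℝ (G x) (G x) :=
  (hNegOneNorm_le_ofReal_iff ENNReal.toReal_nonneg).1 (ENNReal.ofReal_toReal hv).ge χ G hG

theorem IsNegLaplacian.memLp {w : 𝔼 d → ℝ} (hw : IsNegLaplacian bc Ω w h) :
    MemLp w 2 (volume.restrict Ω) :=
  hw.2.elim fun _ hg => hg.1.memLp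

theorem IsNegLaplacian.sq_hNegOneNorm_add_le (hΩ : bc.IsBoundedDomain Ω) {w : 𝔼 d → ℝ}
    (hw : IsNegLaplacian bc Ω w h) (hv : MemLp v 2 (volume.restrict Ω)) {k : ℝ}
    (hfin : hNegOneNorm bc Ω (fun x => v x + k * h x) ≠ ⊤) :
    hNegOneNorm bc Ω v ≠ ⊤ ∧
      (hNegOneNorm bc Ω v).toReal ^ 2 + 2 * k * ∫ x in Ω, v x * w x ≤
        (hNegOneNorm bc Ω fun x => v x + k * h x).toReal ^ 2 := by
  obtain ⟨hh, g, hg, hgrad⟩ := hw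
  have hv₀ : MemLp (fun x => v x + k * h x) 2 (volume.restrict Ω) := hv.add (hh.const_mul k)
  have hstep (q : weakGradients hΩ) :
      pairing hΩ hv q + k * dirichletForm hΩ ⟨(w, g), hg⟩ q = pairing hΩ hv₀ q := by
    have hvq : IntegrableOn (fun x => v x * q.1.1 x) Ω := hv.integrable_mul q.2.memLp
    have hhq : IntegrableOn (fun x => h x * q.1.1 x) Ω := hh.integrable_mul q.2.memLp
    simp only [pairing_apply, dirichletForm_apply, hgrad _ _ q.2, add_mul, mul_assoc]
    rw [integral_add hvq (hhq.const_mul k), integral_const_mul]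
  obtain ⟨hnonneg, hdual⟩ := sq_le_sub_mul_of_add_mul_eq (isPosSemidef_dirichletForm hΩ)
    (sq_nonneg (hNegOneNorm bc Ω fun x => v x + k * h x).toReal) hstep fun q => by
      simpa only [pairing_apply, dirichletForm_apply] using sq_integral_mul_le hfin q.2
  simp only [pairing_apply, dirichletForm_apply] at hnonneg hdual
  have hle := (hNegOneNorm_le_ofReal_iff (Real.sqrt_nonneg _)).2 fun χ G hG =>
    (Real.sq_sqrt hnonneg).symm ▸ hdual ⟨(χ, G), hG⟩
  refine ⟨ne_top_of_le_ne_top ENNReal.ofReal_ne_top hle, le_sub_iff_add_le.1 ?_⟩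
  exact (Real.le_sqrt ENNReal.toReal_nonneg hnonneg).1
    (ENNReal.toReal_le_of_le_ofReal (Real.sqrt_nonneg _) hle)

end EnergySpace

section NegOneConstant

variable {bc : BoundaryCondition} {Ω : Set (𝔼 d)} {v χ : 𝔼 d → ℝ}

theorem ofReal_abs_integral_mul_le {X : Type*} [MeasurableSpace X] {μ : Measure X} {f g : X → ℝ}
    (hf : MemLp f 2 μ) (hg : MemLp g 2 μ) :
    ENNReal.ofReal |∫ x, f x * g x ∂μ| ≤ eLpNorm f 2 μ * eLpNorm g 2 μ := by
  rw [← Real.norm_eq_abs, ofReal_norm]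
  refine (enorm_integral_le_lintegral_enorm _).trans ?_
  rw [← eLpNorm_one_eq_lintegral_enorm]
  exact eLpNorm_smul_le_mul_eLpNorm (φ := f) (p := 2) (q := 2) (r := 1) hg.1 hf.1

section MeanFree

variable [IsFiniteMeasure (volume.restrict Ω)]

theorem memLp_meanFree (hv : MemLp v 2 (volume.restrict Ω)) :
    MemLp (meanFree Ω v) 2 (volume.restrict Ω) :=
  hv.sub (memLp_const _)

theorem integral_meanFree (v : 𝔼 d → ℝ) : ∫ x in Ω, meanFree Ω v x = 0 := by
  simpa [meanFree, mean, setAverage_eq] using integral_sub_average (volume.restrict Ω) v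

theorem integral_meanFree_mul_sub_const (hv : MemLp v 2 (volume.restrict Ω))
    (hχ : MemLp χ 2 (volume.restrict Ω)) (c : ℝ) :
    ∫ x in Ω, meanFree Ω v x * (χ x - c) = ∫ x in Ω, meanFree Ω v x * χ x := by
  have hmul : IntegrableOn (fun x => meanFree Ω v x * χ x) Ω :=
    (memLp_meanFree hv).integrable_mul hχ
  have hconst := ((memLp_meanFree hv).integrable one_le_two).mul_const c
  simp only [mul_sub]
  rw [integral_sub hmul hconst, integral_mul_const, integral_meanFree, zero_mul, sub_zero]

theorem eLpNorm_meanFree_le (hv : MemLp v 2 (volume.restrict Ω)) (c : ℝ) :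
    eLpNorm (meanFree Ω v) 2 (volume.restrict Ω) ≤
      eLpNorm (fun x => v x - c) 2 (volume.restrict Ω) := by
  have hmf := memLp_meanFree hv
  have hsq : ∫ x in Ω, meanFree Ω v x * meanFree Ω v x = ∫ x in Ω, meanFree Ω v x * (v x - c) :=
    (integral_meanFree_mul_sub_const hv hv (mean Ω v)).trans
      (integral_meanFree_mul_sub_const hv hv c).symm
  have hnonneg : 0 ≤ ∫ x in Ω, meanFree Ω v x * meanFree Ω v x :=
    integral_nonneg fun x => mul_self_nonneg _
  have hnorm : eLpNorm (meanFree Ω v) 2 (volume.restrict Ω) *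
      eLpNorm (meanFree Ω v) 2 (volume.restrict Ω) =
        ENNReal.ofReal |∫ x in Ω, meanFree Ω v x * meanFree Ω v x| := by
    rw [eLpNorm_two_eq_ofReal_sqrt hmf, ← ENNReal.ofReal_mul (Real.sqrt_nonneg _),
      Real.mul_self_sqrt (integral_nonneg fun _ => real_inner_self_nonneg), abs_of_nonneg hnonneg]
    simp only [RCLike.inner_apply, conj_trivial]
  have hmul := hnorm.trans_le
    (hsq ▸ ofReal_abs_integral_mul_le hmf (hv.sub (memLp_const c)))
  by_cases hzero : eLpNorm (meanFree Ω v) 2 (volume.restrict Ω) = 0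
  · exact hzero ▸ zero_le
  · exact (ENNReal.mul_le_mul_iff_right hzero hmf.eLpNorm_ne_top).1 hmul

end MeanFree

theorem PoincareOn.exists_eLpNorm_sub_const_le (h : PoincareOn Ω Ω) :
    ∃ K : ℝ≥0∞, K ≠ ⊤ ∧ ∀ v g, IsWeakGradient .neumann Ω v g → ∃ c : ℝ,
      eLpNorm (fun x => v x - c) 2 (volume.restrict Ω) ≤ K * eLpNorm g 2 (volume.restrict Ω) := by
  obtain ⟨C, hC, hP⟩ := h
  refine ⟨C ^ (1 / 2 : ℝ), by finiteness, fun v g hg => (hP v g hg).imp fun c hc => ?_⟩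
  rw [eLpNorm_eq_lintegral_rpow_enorm_toReal two_ne_zero ENNReal.ofNat_ne_top,
    eLpNorm_eq_lintegral_rpow_enorm_toReal two_ne_zero ENNReal.ofNat_ne_top,
    ENNReal.toReal_ofNat, ← ENNReal.mul_rpow_of_nonneg _ _ (by norm_num)]
  simp only [ENNReal.rpow_two]
  gcongr

theorem exists_isNegOneConstant (hΩ : bc.Admissible Ω) : ∃ γ, IsNegOneConstant bc Ω γ := by
  obtain ⟨K, hK, hP⟩ := hΩ.poincareOn.exists_eLpNorm_sub_const_le
  have := hΩ.isBoundedDomain.isFiniteMeasure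
  have hγ : K * K + 1 ≠ ⊤ := by finiteness
  refine ⟨(K * K + 1).toReal, ENNReal.toReal_pos (by simp) hγ, fun v g hg => ?_⟩
  rw [ENNReal.ofReal_toReal hγ]
  refine iSup_le fun χ => iSup_le fun G => iSup_le fun hG => ENNReal.div_le_of_le_mul ?_
  obtain ⟨c, hc⟩ := hP v g (hg.toNeumann hΩ.isBoundedDomain)
  obtain ⟨c', hc'⟩ := hP χ G (hG.toNeumann hΩ.isBoundedDomain)
  calc ENNReal.ofReal |∫ x in Ω, meanFree Ω v x * χ x|
    _ = ENNReal.ofReal |∫ x in Ω, meanFree Ω v x * (χ x - c')| := by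
        rw [integral_meanFree_mul_sub_const hg.memLp hG.memLp]
    _ ≤ eLpNorm (meanFree Ω v) 2 (volume.restrict Ω) *
        eLpNorm (fun x => χ x - c') 2 (volume.restrict Ω) :=
        ofReal_abs_integral_mul_le (memLp_meanFree hg.memLp) (hG.memLp.sub (memLp_const c'))
    _ ≤ K * eLpNorm g 2 (volume.restrict Ω) * (K * eLpNorm G 2 (volume.restrict Ω)) :=
        mul_le_mul' ((eLpNorm_meanFree_le hg.memLp c).trans hc) hc'
    _ = K * K * (eLpNorm g 2 (volume.restrict Ω) * eLpNorm G 2 (volume.restrict Ω)) := by ring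
    _ ≤ (K * K + 1) * (eLpNorm g 2 (volume.restrict Ω) * eLpNorm G 2 (volume.restrict Ω)) := by
        gcongr
        exact le_self_add
    _ = (K * K + 1) * eLpNorm g 2 (volume.restrict Ω) * eLpNorm G 2 (volume.restrict Ω) :=
        (mul_assoc _ _ _).symm

end NegOneConstant

section Recursion

theorem le_mul_exp_neg_of_mul_le {z a s : ℕ → ℝ} {M : ℝ} (hM : 0 ≤ M)
    (ha : ∀ n, Real.exp (s (n + 1) - s n) ≤ a n) (h : ∀ n, z (n + 1) * a n ≤ z n)
    (h0 : z 0 ≤ M * Real.exp (-s 0)) (n : ℕ) : z n ≤ M * Real.exp (-s n) := by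
  induction n with
  | zero => exact h0
  | succ n ih =>
    refine le_of_mul_le_mul_right ?_ ((Real.exp_pos _).trans_le (ha n))
    calc z (n + 1) * a n ≤ M * Real.exp (-s n) := (h n).trans ih
      _ = M * Real.exp (-s (n + 1)) * Real.exp (s (n + 1) - s n) := by
          rw [mul_assoc, ← Real.exp_add]
          ring_nf
      _ ≤ M * Real.exp (-s (n + 1)) * a n := by gcongr; exact ha n

theorem exp_div_add_le {g K k : ℝ} (hg : 0 < g) (hk : 0 ≤ k) (hkK : k ≤ K) :
    Real.exp (k / (g + K)) ≤ 1 + 2 * k / g := by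
  have hT : 0 < g + K := by linarith
  have hlt : 0 < 1 - k / (g + K) := by
    rw [sub_pos, div_lt_one hT]
    linarith
  have hinv : Real.exp (k / (g + K)) ≤ (1 - k / (g + K))⁻¹ := by
    rw [le_inv_comm₀ (Real.exp_pos _) hlt, ← Real.exp_neg]
    exact Real.one_sub_le_exp_neg _
  refine hinv.trans (inv_le_of_inv_le₀ (by positivity) ?_)
  rw [inv_le_iff_one_le_mul₀ (by positivity), ← sub_nonneg]
  have hprod : (1 - k / (g + K)) * (1 + 2 * k / g) - 1 =
      k * (g + 2 * (K - k)) / (g * (g + K)) := by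
    field_simp
    ring
  have : 0 ≤ K - k := sub_nonneg.2 hkK
  rw [hprod]
  positivity

theorem mul_exp_neg_le_of_log_div_le {a b s : ℝ} (hb : 0 < b) (h : Real.log (a / b) ≤ s) :
    a * Real.exp (-s) ≤ b := by
  rw [Real.exp_neg, ← div_eq_mul_inv, div_le_comm₀ (Real.exp_pos s) hb]
  exact (Real.le_exp_log _).trans (Real.exp_le_exp.2 h)

variable {y t : ℕ → ℝ} {g K C : ℝ}

theorem sub_mul_one_add_le (hg : g ≠ 0) {k a b : ℝ} (h : b * (1 + 2 * k / g) ≤ a + 2 * k * C) :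
    (b - C * g) * (1 + 2 * k / g) ≤ a - C * g := by
  have : C * g * (1 + 2 * k / g) = C * g + 2 * k * C := by field_simp
  linarith

theorem le_of_euler_recursion (hg : 0 < g) (ht : Monotone t)
    (h : ∀ n, y (n + 1) * (1 + 2 * (t (n + 1) - t n) / g) ≤ y n + 2 * (t (n + 1) - t n) * C)
    {M : ℝ} (h0 : y 0 ≤ M) (hM : C * g ≤ M) (n : ℕ) : y n ≤ M := by
  have hstep (n) : 0 ≤ t (n + 1) - t n := sub_nonneg.2 (ht n.le_succ)
  have := le_mul_exp_neg_of_mul_le (z := fun n => y n - C * g) (s := 0) (sub_nonneg.2 hM)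
    (fun n => by simpa using div_nonneg (mul_nonneg zero_le_two (hstep n)) hg.le)
    (fun n => sub_mul_one_add_le hg.ne' (h n)) (by simpa) n
  simpa using this

theorem le_add_mul_exp_neg_of_euler_recursion (hg : 0 < g) (ht : Monotone t) (ht0 : t 0 = 0)
    (htK : ∀ n, t (n + 1) - t n ≤ K)
    (h : ∀ n, y (n + 1) * (1 + 2 * (t (n + 1) - t n) / g) ≤ y n + 2 * (t (n + 1) - t n) * C)
    {M : ℝ} (hM : 0 ≤ M) (hC : 0 ≤ C) (h0 : y 0 ≤ M) (n : ℕ) :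
    y n ≤ C * g + M * Real.exp (-(t n / (g + K))) := by
  refine sub_le_iff_le_add'.1 (le_mul_exp_neg_of_mul_le (z := fun n => y n - C * g)
    (s := fun n => t n / (g + K)) hM (fun n => ?_) (fun n => sub_mul_one_add_le hg.ne' (h n)) ?_ n)
  · rw [← sub_div]
    exact exp_div_add_le hg (sub_nonneg.2 (ht n.le_succ)) (htK n)
  · simp only [ht0, zero_div, neg_zero, Real.exp_zero, mul_one]
    exact (sub_le_self _ (mul_nonneg hC hg.le)).trans h0

end Recursion

section EulerStep

variable {bc : BoundaryCondition} {Ω : Set (𝔼 d)} {f : ℝ → ℝ} {ε γ k α b : ℝ}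
  {u u₀ u₁ a w : 𝔼 d → ℝ}

theorem neg_le_sub_mul_of_growth {p c₀ c₁ c₃ m : ℝ} {c₂ : ℝ → ℝ} (hp : 3 / 2 < p) (hc₀ : 0 ≤ c₀)
    (hc₃ : 0 ≤ c₃) (hlower : ∀ v, p * c₀ * |v| ^ (2 * p) - c₁ ≤ f v * v)
    (hgrowth : ∀ η, 0 < η → ∀ v, |f v| ≤ η * c₀ * |v| ^ (2 * p) + c₂ η) (hm : |m| ≤ α) (v : ℝ) :
    -(c₁ + c₂ ((p - 3 / 2) / α) * α + 2 * c₃) ≤ (v - m) * f v := by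
  have hpow : 0 ≤ c₀ * |v| ^ (2 * p) := by positivity
  have hα : 0 ≤ α := (abs_nonneg m).trans hm
  have hmf : m * f v ≤ α * |f v| := (le_abs_self _).trans (by rw [abs_mul]; gcongr)
  have hαf : α * |f v| ≤ (p - 3 / 2) * (c₀ * |v| ^ (2 * p)) + c₂ ((p - 3 / 2) / α) * α := by
    rcases hα.eq_or_lt with rfl | hα
    · simpa using mul_nonneg (sub_pos.2 hp).le hpow
    · calc α * |f v|
        _ ≤ α * ((p - 3 / 2) / α * c₀ * |v| ^ (2 * p) + c₂ ((p - 3 / 2) / α)) := by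
            gcongr
            exact hgrowth _ (div_pos (sub_pos.2 hp) hα) v
        _ = (p - 3 / 2) * (c₀ * |v| ^ (2 * p)) + c₂ ((p - 3 / 2) / α) * α := by field_simp
  linarith [hlower v]

theorem IsNonlinearity.c₃_nonneg {p : ℝ} {F : ℝ → ℝ} {c₀ c₁ c₃ : ℝ} {c₂ : ℝ → ℝ}
    (hf : IsNonlinearity d p f F c₀ c₁ c₂ c₃) : 0 ≤ c₃ := by
  have hF := hf.primitive_lower 0
  rw [hf.primitive_zero, abs_zero, Real.zero_rpow (by linarith [hf.two_le])] at hF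
  linarith

theorem IsNegLaplacian.integral_eq_zero (hΩ : bc.IsBoundedDomain Ω)
    (hu : IsNegLaplacian bc Ω u a) : ∫ x in Ω, a x = 0 := by
  obtain ⟨-, g, -, hg⟩ := hu
  simpa using (hg _ _ (isWeakGradient_const hΩ 1)).symm

theorem IsNegLaplacian.mean_eq (hΩ : bc.IsBoundedDomain Ω) (hk : k ≠ 0)
    (hu₀ : MemLp u₀ 2 (volume.restrict Ω)) (hu₁ : MemLp u₁ 2 (volume.restrict Ω))
    (hw : IsNegLaplacian bc Ω w fun x => -((u₁ x - u₀ x) / k)) : mean Ω u₁ = mean Ω u₀ := by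
  have := hΩ.isFiniteMeasure
  have hzero := hw.integral_eq_zero hΩ
  rw [integral_neg, integral_div, integral_sub (hu₁.integrable one_le_two)
    (hu₀.integrable one_le_two), neg_eq_zero, div_eq_zero_iff, or_iff_left hk, sub_eq_zero] at hzero
  rw [mean, mean, hzero]

theorem IsNegOneConstant.sq_hNegOneNorm_le (hγ : IsNegOneConstant bc Ω γ)
    (hΩ : bc.IsBoundedDomain Ω) (hu : IsNegLaplacian bc Ω u a) :
    (hNegOneNorm bc Ω (meanFree Ω u)).toReal ^ 2 ≤ γ ^ 2 * ∫ x in Ω, meanFree Ω u x * a x := by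
  obtain ⟨-, g, hg, hgrad⟩ := hu
  have henergy : ∫ x in Ω, meanFree Ω u x * a x = ∫ x in Ω, inner ℝ (g x) (g x) := by
    rw [hgrad _ _ (hg.sub_const hΩ (mean Ω u))]
    simp only [meanFree, mul_comm]
  have hle := hγ.2 u g hg
  rw [eLpNorm_two_eq_ofReal_sqrt hg.memLp_grad, ← ENNReal.ofReal_mul hγ.1.le] at hle
  have hγg : 0 ≤ γ * √(∫ x in Ω, inner ℝ (g x) (g x)) := mul_nonneg hγ.1.le (Real.sqrt_nonneg _)
  calc (hNegOneNorm bc Ω (meanFree Ω u)).toReal ^ 2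
    _ ≤ (γ * √(∫ x in Ω, inner ℝ (g x) (g x))) ^ 2 := by
        gcongr
        exact ENNReal.toReal_le_of_le_ofReal hγg hle
    _ = γ ^ 2 * ∫ x in Ω, meanFree Ω u x * a x := by
        rw [mul_pow, Real.sq_sqrt (integral_nonneg fun _ => real_inner_self_nonneg), henergy]

theorem le_integral_meanFree_mul_potential (hΩ : bc.IsBoundedDomain Ω)
    (hγ : IsNegOneConstant bc Ω γ) (hε : 0 ≤ ε) (hf : ∀ v, -b ≤ (v - mean Ω u) * f v)
    (hu : IsNegLaplacian bc Ω u a) (hw : MemLp w 2 (volume.restrict Ω))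
    (hwa : ∀ᵐ x ∂volume.restrict Ω, w x = ε * a x + f (u x)) :
    (hNegOneNorm bc Ω (meanFree Ω u)).toReal ^ 2 / (γ ^ 2 / ε) - b * volume.real Ω ≤
      ∫ x in Ω, meanFree Ω u x * w x := by
  have := hΩ.isFiniteMeasure
  have hmf := memLp_meanFree hu.memLp
  have hfu : MemLp (fun x => f (u x)) 2 (volume.restrict Ω) :=
    (hw.sub (hu.1.const_mul ε)).ae_eq (hwa.mono fun x hx => by simp [hx])
  have hint : IntegrableOn (fun x => meanFree Ω u x * f (u x)) Ω := hmf.integrable_mul hfu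
  have hinta : IntegrableOn (fun x => meanFree Ω u x * a x) Ω := hmf.integrable_mul hu.1
  have henergy : ∫ x in Ω, meanFree Ω u x * w x =
      ε * (∫ x in Ω, meanFree Ω u x * a x) + ∫ x in Ω, meanFree Ω u x * f (u x) := by
    rw [← integral_const_mul, ← integral_add (hinta.const_mul ε) hint]
    exact integral_congr_ae (hwa.mono fun x hx => by simp only [hx]; ring)
  have hreaction : -(b * volume.real Ω) ≤ ∫ x in Ω, meanFree Ω u x * f (u x) := by
    simpa [mul_comm] using integral_mono (integrable_const (-b)) hint fun x => hf (u x)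
  have hdiffusion : (hNegOneNorm bc Ω (meanFree Ω u)).toReal ^ 2 / (γ ^ 2 / ε) ≤
      ε * ∫ x in Ω, meanFree Ω u x * a x := by
    rw [div_div_eq_mul_div, div_le_iff₀ (pow_pos hγ.1 2)]
    linarith [mul_le_mul_of_nonneg_right (hγ.sq_hNegOneNorm_le hΩ hu) hε]
  linarith

theorem euler_step_hNegOneNorm_le (hΩ : bc.IsBoundedDomain Ω) (hγ : IsNegOneConstant bc Ω γ)
    (hε : 0 ≤ ε) (hk : 0 < k) (hf : ∀ v, -b ≤ (v - mean Ω u₀) * f v)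
    (hu₀ : MemLp u₀ 2 (volume.restrict Ω)) (hfin : hNegOneNorm bc Ω (meanFree Ω u₀) ≠ ⊤)
    (hu₁ : IsNegLaplacian bc Ω u₁ a)
    (hwa : ∀ᵐ x ∂volume.restrict Ω, w x = ε * a x + f (u₁ x))
    (hw : IsNegLaplacian bc Ω w fun x => -((u₁ x - u₀ x) / k)) :
    hNegOneNorm bc Ω (meanFree Ω u₁) ≠ ⊤ ∧
      (hNegOneNorm bc Ω (meanFree Ω u₁)).toReal ^ 2 * (1 + 2 * k / (γ ^ 2 / ε)) ≤
        (hNegOneNorm bc Ω (meanFree Ω u₀)).toReal ^ 2 + 2 * k * (b * volume.real Ω) := by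
  have := hΩ.isFiniteMeasure
  have hmean := hw.mean_eq hΩ hk.ne' hu₀ hu₁.memLp
  have hprev : (fun x => meanFree Ω u₁ x + k * -((u₁ x - u₀ x) / k)) = meanFree Ω u₀ := by
    ext x
    simp only [meanFree, hmean]
    field_simp
    ring
  have hdual := hw.sq_hNegOneNorm_add_le hΩ (memLp_meanFree hu₁.memLp) (hprev ▸ hfin)
  rw [hprev] at hdual
  have hpotential := le_integral_meanFree_mul_potential hΩ hγ hε (hmean ▸ hf) hu₁ hw.memLp hwa
  refine ⟨hdual.1, ?_⟩
  calc _ = (hNegOneNorm bc Ω (meanFree Ω u₁)).toReal ^ 2 +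
        2 * k * ((hNegOneNorm bc Ω (meanFree Ω u₁)).toReal ^ 2 / (γ ^ 2 / ε)) := by ring
    _ ≤ _ := by linarith [hdual.2, mul_le_mul_of_nonneg_left hpotential hk.le]

end EulerStep

section Scheme

variable {bc : BoundaryCondition} {Ω : Set (𝔼 d)} {f : ℝ → ℝ} {ε γ α b : ℝ} {t : ℕ → ℝ}
  {u : ℕ → 𝔼 d → ℝ}

theorem IsImplicitEuler.memLp (hu : IsImplicitEuler bc Ω ε f t u) :
    ∀ n, MemLp (u n) 2 (volume.restrict Ω)
  | 0 => hu.1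
  | n + 1 => (hu.2 n).elim fun _ ⟨_, ha, _⟩ => ha.memLp

theorem IsImplicitEuler.mean_eq (hu : IsImplicitEuler bc Ω ε f t u) (hΩ : bc.IsBoundedDomain Ω)
    (ht : StrictMono t) (n : ℕ) : mean Ω (u n) = mean Ω (u 0) := by
  induction n with
  | zero => rfl
  | succ n ih =>
    obtain ⟨_, _, -, -, hw⟩ := hu.2 n
    have hk : t (n + 1) - t n ≠ 0 := (sub_pos.2 (ht n.lt_succ_self)).ne'
    exact (hw.mean_eq hΩ hk (hu.memLp n) (hu.memLp (n + 1))).trans ih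

theorem IsImplicitEuler.hNegOneNorm_succ_le (hu : IsImplicitEuler bc Ω ε f t u)
    (hΩ : bc.IsBoundedDomain Ω) (hγ : IsNegOneConstant bc Ω γ) (hε : 0 ≤ ε) (ht : StrictMono t)
    (hf : ∀ v, -b ≤ (v - mean Ω (u 0)) * f v) {n : ℕ}
    (hfin : hNegOneNorm bc Ω (meanFree Ω (u n)) ≠ ⊤) :
    hNegOneNorm bc Ω (meanFree Ω (u (n + 1))) ≠ ⊤ ∧
      (hNegOneNorm bc Ω (meanFree Ω (u (n + 1)))).toReal ^ 2 *
          (1 + 2 * (t (n + 1) - t n) / (γ ^ 2 / ε)) ≤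
        (hNegOneNorm bc Ω (meanFree Ω (u n))).toReal ^ 2 +
          2 * (t (n + 1) - t n) * (b * volume.real Ω) := by
  obtain ⟨_, _, ha, hwa, hw⟩ := hu.2 n
  exact euler_step_hNegOneNorm_le hΩ hγ hε (sub_pos.2 (ht n.lt_succ_self))
    (by rwa [hu.mean_eq hΩ ht n]) (hu.memLp n) hfin ha hwa hw

theorem IsImplicitEuler.hNegOneNorm_ne_top (hu : IsImplicitEuler bc Ω ε f t u)
    (hΩ : bc.IsBoundedDomain Ω) (hγ : IsNegOneConstant bc Ω γ) (hε : 0 ≤ ε) (ht : StrictMono t)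
    (hf : ∀ v, -b ≤ (v - mean Ω (u 0)) * f v) (h0 : hNegOneNorm bc Ω (meanFree Ω (u 0)) ≠ ⊤)
    (n : ℕ) : hNegOneNorm bc Ω (meanFree Ω (u n)) ≠ ⊤ := by
  induction n with
  | zero => exact h0
  | succ n ih => exact (hu.hNegOneNorm_succ_le hΩ hγ hε ht hf ih).1

theorem hNegOneNorm_le_ofReal_of_sq_le {v : 𝔼 d → ℝ} {r : ℝ} (hr : 0 ≤ r)
    (hv : hNegOneNorm bc Ω v ≠ ⊤) (h : (hNegOneNorm bc Ω v).toReal ^ 2 ≤ r ^ 2) :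
    hNegOneNorm bc Ω v ≤ ENNReal.ofReal r :=
  (ENNReal.le_ofReal_iff_toReal_le hv hr).2 (le_of_sq_le_sq h hr)

variable {R K ρ : ℝ}

theorem IsImplicitEuler.hNegOneNorm_le_max (hu : IsImplicitEuler bc Ω ε f t u)
    (hΩ : bc.IsBoundedDomain Ω) (hγ : IsNegOneConstant bc Ω γ) (hε : 0 < ε) (ht : StrictMono t)
    (hf : ∀ v, -b ≤ (v - mean Ω (u 0)) * f v) (hR : 0 ≤ R)
    (h0 : hNegOneNorm bc Ω (meanFree Ω (u 0)) ≤ ENNReal.ofReal R)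
    (hρ : b * volume.real Ω * (γ ^ 2 / ε) ≤ ρ ^ 2) (hρ0 : 0 ≤ ρ) (n : ℕ) :
    hNegOneNorm bc Ω (meanFree Ω (u n)) ≤ ENNReal.ofReal (max R ρ) := by
  have hfin := hu.hNegOneNorm_ne_top hΩ hγ hε.le ht hf
    (ne_top_of_le_ne_top ENNReal.ofReal_ne_top h0)
  refine hNegOneNorm_le_ofReal_of_sq_le (le_max_of_le_left hR) (hfin n) ?_
  refine le_of_euler_recursion (y := fun n => (hNegOneNorm bc Ω (meanFree Ω (u n))).toReal ^ 2)
    (div_pos (pow_pos hγ.1 2) hε) ht.monotone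
    (fun n => (hu.hNegOneNorm_succ_le hΩ hγ hε.le ht hf (hfin n)).2) ?_ ?_ n
  · gcongr
    exact (ENNReal.toReal_le_of_le_ofReal hR h0).trans (le_max_left R ρ)
  · exact hρ.trans (by gcongr; exact le_max_right R ρ)

theorem IsImplicitEuler.hNegOneNorm_le_two_mul (hu : IsImplicitEuler bc Ω ε f t u)
    (hΩ : bc.IsBoundedDomain Ω) (hγ : IsNegOneConstant bc Ω γ) (hε : 0 < ε) (ht : IsTimeGrid t)
    (htK : ∀ n, t (n + 1) - t n ≤ K) (hb : 0 ≤ b) (hf : ∀ v, -b ≤ (v - mean Ω (u 0)) * f v)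
    (hR : 0 ≤ R) (h0 : hNegOneNorm bc Ω (meanFree Ω (u 0)) ≤ ENNReal.ofReal R)
    (hρ : b * volume.real Ω * (γ ^ 2 / ε) ≤ ρ ^ 2) (hρ0 : 0 < ρ) {n : ℕ}
    (hn : Real.log (R ^ 2 / ρ ^ 2) ≤ t n / (γ ^ 2 / ε + K)) :
    hNegOneNorm bc Ω (meanFree Ω (u n)) ≤ ENNReal.ofReal (2 * ρ) := by
  have hfin := hu.hNegOneNorm_ne_top hΩ hγ hε.le ht.strictMono hf
    (ne_top_of_le_ne_top ENNReal.ofReal_ne_top h0)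
  have hinit : (hNegOneNorm bc Ω (meanFree Ω (u 0))).toReal ^ 2 ≤ R ^ 2 := by
    gcongr
    exact ENNReal.toReal_le_of_le_ofReal hR h0
  have hdecay := le_add_mul_exp_neg_of_euler_recursion
    (y := fun n => (hNegOneNorm bc Ω (meanFree Ω (u n))).toReal ^ 2) (div_pos (pow_pos hγ.1 2) hε)
    ht.strictMono.monotone ht.zero htK
    (fun n => (hu.hNegOneNorm_succ_le hΩ hγ hε.le ht.strictMono hf (hfin n)).2) (sq_nonneg R)
    (mul_nonneg hb measureReal_nonneg) hinit n
  have hlog := mul_exp_neg_le_of_log_div_le (pow_pos hρ0 2) hn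
  exact hNegOneNorm_le_ofReal_of_sq_le (by positivity) (hfin n) (by nlinarith)

end Scheme

section Radius

variable {Ω : Set (𝔼 d)} {p c₁ c₃ c ε γ α : ℝ} {c₂ : ℝ → ℝ}

theorem rhoHat_nonneg : 0 ≤ rhoHat Ω p c₁ c₂ c₃ c ε γ α :=
  mul_nonneg (Real.sqrt_nonneg _) (Real.sqrt_nonneg _)

theorem C₁_mul_le_sq_rhoHat (hε : 0 ≤ ε) (hC : 0 ≤ C₁ Ω p c₁ c₂ c₃ α) :
    C₁ Ω p c₁ c₂ c₃ α * (γ ^ 2 / ε) ≤ rhoHat Ω p c₁ c₂ c₃ c ε γ α ^ 2 := by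
  have hg : 0 ≤ γ ^ 2 / ε := by positivity
  have hK : 0 ≤ 8 * ε / c ^ 2 := by positivity
  rw [rhoHat, mul_pow, Real.sq_sqrt (by positivity), Real.sq_sqrt (by positivity)]
  nlinarith [mul_nonneg hC hg, mul_nonneg hC hK]

end Radius

end CahnHilliard

end

open CahnHilliard in
theorem mainTheorem5_general {d : ℕ} {bc : BoundaryCondition}
    {Ω : Set (EuclideanSpace ℝ (Fin d))} (hΩ : bc.IsBoundedDomain Ω) {γ₁ : ℝ}
    (hγ : IsNegOneConstant bc Ω γ₁) {p : ℝ} {f : ℝ → ℝ} {c₀ c₁ : ℝ} {c₂ : ℝ → ℝ}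
    {c₃ : ℝ} (hp : 3 / 2 < p) (hc₀ : 0 ≤ c₀) (hc₃ : 0 ≤ c₃)
    (hlower : ∀ v, p * c₀ * |v| ^ (2 * p) - c₁ ≤ f v * v)
    (hgrowth : ∀ η, 0 < η → ∀ v, |f v| ≤ η * c₀ * |v| ^ (2 * p) + c₂ η)
    {ε c α R : ℝ} (hε : 0 < ε) (hc : 0 < c) (hR : 0 ≤ R) {t : ℕ → ℝ}
    (ht : IsTimeGrid t) (htk : ∀ n, t (n + 1) - t n ≤ 8 * ε / c ^ 2)
    {u : ℕ → EuclideanSpace ℝ (Fin d) → ℝ} (hu : IsImplicitEuler bc Ω ε f t u)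
    (hu₀ : hNegOneNorm bc Ω (meanFree Ω (u 0)) ≤ ENNReal.ofReal R)
    (hα : |mean Ω (u 0)| ≤ α) :
    (∀ n, hNegOneNorm bc Ω (meanFree Ω (u n)) ≤
      ENNReal.ofReal (max R (rhoHat Ω p c₁ c₂ c₃ c ε γ₁ α))) ∧
    (0 < rhoHat Ω p c₁ c₂ c₃ c ε γ₁ α →
      (∃ n₀ : ℕ, 1 ≤ n₀ ∧ (γ₁ ^ 2 / ε + 8 * ε / c ^ 2) *
        Real.log (R ^ 2 / rhoHat Ω p c₁ c₂ c₃ c ε γ₁ α ^ 2) ≤ t n₀) ∧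
      ∀ n₀ : ℕ, (γ₁ ^ 2 / ε + 8 * ε / c ^ 2) *
        Real.log (R ^ 2 / rhoHat Ω p c₁ c₂ c₃ c ε γ₁ α ^ 2) ≤ t n₀ →
      ∀ n, n₀ ≤ n → hNegOneNorm bc Ω (meanFree Ω (u n)) ≤
        ENNReal.ofReal (2 * rhoHat Ω p c₁ c₂ c₃ c ε γ₁ α)) := by
  have hreaction {m : ℝ} (hm : |m| ≤ α) := neg_le_sub_mul_of_growth
    hp hc₀ hc₃ hlower hgrowth hm
  have hb : 0 ≤ c₁ + c₂ ((p - 3 / 2) / α) * α + 2 * c₃ := by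
    simpa only [sub_zero, zero_mul, Left.neg_nonpos_iff] using
      hreaction (m := 0) (by simpa only [abs_zero] using (abs_nonneg _).trans hα) 0
  have hρ : C₁ Ω p c₁ c₂ c₃ α * (γ₁ ^ 2 / ε) ≤
      rhoHat Ω p c₁ c₂ c₃ c ε γ₁ α ^ 2 :=
    C₁_mul_le_sq_rhoHat hε.le (mul_nonneg hb measureReal_nonneg)
  have hrate : 0 < γ₁ ^ 2 / ε + 8 * ε / c ^ 2 :=
    add_pos (div_pos (pow_pos hγ.1 2) hε) (div_pos (by positivity) (pow_pos hc 2))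
  refine ⟨hu.hNegOneNorm_le_max hΩ hγ hε ht.strictMono (hreaction hα) hR hu₀ hρ
    rhoHat_nonneg, fun hρ₀ => ⟨?_, fun n₀ hn₀ n hn => ?_⟩⟩
  · exact ((eventually_ge_atTop 1).and (ht.tendsto.eventually_ge_atTop _)).exists
  · exact hu.hNegOneNorm_le_two_mul hΩ hγ hε ht htk hb (hreaction hα) hR hu₀ hρ hρ₀
      ((le_div_iff₀' hrate).2 (hn₀.trans (ht.strictMono.monotone hn)))

theorem mainTheorem5 {d : ℕ} (hd : 1 ≤ d) (hd3 : d ≤ 3) (bc : CahnHilliard.BoundaryCondition)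
    (Ω : Set (EuclideanSpace ℝ (Fin d))) (hΩ : bc.Admissible Ω) :
    (∃ γ₁ : ℝ, CahnHilliard.IsNegOneConstant bc Ω γ₁) ∧
    ∀ γ₁ : ℝ, CahnHilliard.IsNegOneConstant bc Ω γ₁ →
    ∀ (p : ℝ) (f F : ℝ → ℝ) (c₀ c₁ : ℝ) (c₂ : ℝ → ℝ) (c₃ : ℝ),
    CahnHilliard.IsNonlinearity d p f F c₀ c₁ c₂ c₃ →
    ∀ ε c α R : ℝ, 0 < ε → 0 < c → 0 ≤ R →
    ∀ (t : ℕ → ℝ) (k : ℝ), CahnHilliard.IsTimeGrid t →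
    IsLUB (Set.range fun n => t (n + 1) - t n) k → k ≤ 8 * ε / c ^ 2 →
    ∀ u : ℕ → EuclideanSpace ℝ (Fin d) → ℝ,
    CahnHilliard.IsImplicitEuler bc Ω ε f t u →
    CahnHilliard.hNegOneNorm bc Ω (CahnHilliard.meanFree Ω (u 0)) ≤ ENNReal.ofReal R →
    |CahnHilliard.mean Ω (u 0)| ≤ α →
    (∀ n, CahnHilliard.hNegOneNorm bc Ω (CahnHilliard.meanFree Ω (u n)) ≤
      ENNReal.ofReal (max R (CahnHilliard.rhoHat Ω p c₁ c₂ c₃ c ε γ₁ α))) ∧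
    (0 < CahnHilliard.rhoHat Ω p c₁ c₂ c₃ c ε γ₁ α →
      (∃ n₀ : ℕ, 1 ≤ n₀ ∧ (γ₁ ^ 2 / ε + 8 * ε / c ^ 2) *
        Real.log (R ^ 2 / CahnHilliard.rhoHat Ω p c₁ c₂ c₃ c ε γ₁ α ^ 2) ≤ t n₀) ∧
      ∀ n₀ : ℕ, (γ₁ ^ 2 / ε + 8 * ε / c ^ 2) *
        Real.log (R ^ 2 / CahnHilliard.rhoHat Ω p c₁ c₂ c₃ c ε γ₁ α ^ 2) ≤ t n₀ →
      ∀ n, n₀ ≤ n → CahnHilliard.hNegOneNorm bc Ω (CahnHilliard.meanFree Ω (u n)) ≤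
        ENNReal.ofReal (2 * CahnHilliard.rhoHat Ω p c₁ c₂ c₃ c ε γ₁ α)) :=
  ⟨CahnHilliard.exists_isNegOneConstant hΩ, fun _ hγ _ _ _ _ _ _ _ hf _ _ _ _ hε hc hR _ _ ht hk hkK
    _ hu hu₀ hα => mainTheorem5_general hΩ.isBoundedDomain hγ (by linarith [hf.two_le]) hf.c₀_pos.le
      hf.c₃_nonneg hf.lower hf.growth hε hc hR ht (fun n => (hk.1 ⟨n, rfl⟩).trans hkK) hu hu₀ hα⟩
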